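/- **Theorem.** Let $n\ge 1$. *The network on the torus.* Consider the network with $n$ square faces, indexed cyclically modulo $n$. Square $i$ has edges $\alpha_i$ (left, from the bottom left to the top left corner), $\beta_i$ (bottom, from bottom left to bottom right), $\gamma_i$ (right, from top right to bottom right), $\delta_i$ (top, from top left to top right); moreover there are edges $\varepsilon_i$ from the top right corner of square $i$ to the bottom left corner of square $i+2$, and $\bar\varepsilon_i$ from the bottom right corner of square $i$ to the top left corner of square $i+1$. (Bottom left and top right corners are white, the others black.) Let $A$ be the $\mathbb Q$-algebra of noncommutative Laurent polynomials in these $6n$ edges (the group algebra of the free group on them). *The bracket.* A double bracket on $A$ is a $\mathbb Q$-bilinear map $A\times A\to A\otimes A$ with $\{\!\{x,yz\}\!\}=\{\!\{x,y\}\!\}(1\otimes z)+(y\otimes 1)\{\!\{x,z\}\!\}$ and $\{\!\{y,x\}\!\}=-\tau\{\!\{x,y\}\!\}$, where $\tau(u\otimes v)=v\otimes u$. Let $\{\!\{-,-\}\!\}$ be the double bracket on $A$ with $$\{\!\{\beta_i,\alpha_i\}\!\}=\tfrac12\,\beta_i\otimes\alpha_i,\quad \{\!\{\beta_i,\gamma_i\}\!\}=\tfrac12\,\gamma_i\otimes\beta_i,\quad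 \{\!\{\alpha_i,\bar\varepsilon_{i-1}\}\!\}=\tfrac12\,\bar\varepsilon_{i-1}\otimes\alpha_i,\quad \{\!\{\gamma_i,\varepsilon_i\}\!\}=\tfrac12\,\gamma_i\otimes\varepsilon_i,$$ all other double brackets of two edges being $0$, up to skew-symmetry. Let $A^\natural=A/[A,A]$ be the quotient by the linear span of all commutators, and let $\langle-,-\rangle\colon A^\natural\times A^\natural\to A^\natural$ be the induced bracket: $\langle x^\natural,y^\natural\rangle=(\mu\{\!\{x,y\}\!\})^\natural$ with $\mu$ the multiplication of $A$. *The weights.* Put $a_i=\alpha_i\bar\varepsilon_{i-1}^{-1}$, $b_i=\beta_i$, $c_i=\varepsilon_i^{-1}\gamma_i$, $d_i=\bar\varepsilon_{i-1}\delta_i\varepsilon_i$, $$x_i=a_ic_{i-1}^{-1}d_{i-1}^{-1}c_{i-2}^{-1},\qquad y_i=b_ic_i^{-1}d_i^{-1}c_{i-1}^{-1}d_{i-1}^{-1}c_{i-2}^{-1},$$ $$w_i=(d_1c_1\cdots d_{i-1}c_{i-1})\,c_{i-1}^{-1}d_{i-1}^{-1}c_{i-2}^{-1},\quad X_i=w_ix_iw_i^{-1},\quad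 Y_i=w_iy_iw_i^{-1}\quad(1\le i\le n),\qquad Z=d_1c_1\cdots d_nc_n .$$ *The boundary measurement matrix.* Let $Q_n$ be the acyclic network on the cylinder obtained by cutting the torus between square $n$ and square $1$: it has the squares $1,\dots,n$; the sources $1,2,3$ are the starts of the edges leading to the top left corner of square $1$, the bottom left corner of square $1$ and the bottom left corner of square $2$; and the edges that would lead to the top left corner of square $n+1$ and to the bottom left corners of squares $n+1$ and $n+2$ end at the sinks $1,2,3$ respectively. (For $n=1$, the edge starting at source $3$ ends at sink $2$.) Give the left and the bottom edge of square $i$ the weights $X_i$ and $Y_i$, all other edges the weight $1$, and multiply the weight of each edge ending at a sink by $Z$. The cut crosses each edge joining two white vertices once, so the weight of the edge leaving the top right corner of each square $i$ other than $\gamma_i$ is also multiplied by a central variable $\lambda$. Let $\mathscr B(\lambda)$ be the $3\times3$ matrix whose $(p,q)$ entry is the sum, over all directed paths from source $p$ to sink $q$ in $Q_n$, of the ordered product of the edge weights, an element of $A[\lambda^{\pm1}]$. For $i\ge1$ and $k\in\mathbb Z$ let $t_{ik}\in A$ be the coefficient of $\lambda^k$ in $\mathrm{tr}(\mathscr B(\lambda)^i)$.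 Then for all $i,j\ge 1$ and all $k,\ell\in\mathbb Z$: $$\langle t_{ik}^\natural,\,t_{j\ell}^\natural\rangle=0\quad\text{in } A^\natural .$$ -/

import Mathlib

open scoped TensorProduct

noncomputable section

namespace GrassmannPentagram

/-! ### Double brackets and the cyclic space -/

section DoubleBrackets

variable (A : Type*) [Ring A] [Algebra ℚ A]

/-- A double bracket on an associative `ℚ`-algebra: a bilinear map `A × A → A ⊗ A` which is a
freeDeration in the second argument for the outer bimodule structure on `A ⊗ A`, and which is
skew-symmetric up to exchanging the two tensor factors. -/
structure DoubleBracket where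
  /-- the underlying bilinear map -/
  db : A →ₗ[ℚ] A →ₗ[ℚ] A ⊗[ℚ] A
  leibniz : ∀ a b c : A, db a (b * c) = db a b * (1 ⊗ₜ[ℚ] c) + (b ⊗ₜ[ℚ] 1) * db a c
  skew : ∀ a b : A, db b a = -TensorProduct.comm ℚ A A (db a b)

/-- The linear span `[A, A]` of all commutators. -/
def commutators : Submodule ℚ A := Submodule.span ℚ {x | ∃ a b : A, x = a * b - b * a}

/-- The cyclic space `A / [A, A]`, a quotient vector space. -/
abbrev CyclicSpace : Type _ := A ⧸ commutators A

variable {A}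

/-- The class of an element of `A` in the cyclic space. -/
def cyc : A →ₗ[ℚ] CyclicSpace A := (commutators A).mkQ

theorem cyc_mul_comm (a b : A) : cyc (a * b) = cyc (b * a) := by
  refine (Submodule.Quotient.eq _).2 (Submodule.subset_span ⟨a, b, rfl⟩)

namespace DoubleBracket

variable (D : DoubleBracket A)

/-- The single bracket `{a, b}`, obtained from the double bracket by multiplying the two
tensor factors. -/
def single : A →ₗ[ℚ] A →ₗ[ℚ] A := D.db.compr₂ (LinearMap.mul' ℚ A)

theorem single_mul (a b c : A) : D.single a (b * c) = D.single a b * c + b * D.single a c := by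
  have h1 : ∀ x : A ⊗[ℚ] A,
      LinearMap.mul' ℚ A (x * (1 ⊗ₜ[ℚ] c)) = LinearMap.mul' ℚ A x * c := by
    intro x
    induction x with
    | zero => simp
    | tmul u v => simp [mul_assoc]
    | add u v hu hv => simp [add_mul, hu, hv]
  have h2 : ∀ x : A ⊗[ℚ] A,
      LinearMap.mul' ℚ A ((b ⊗ₜ[ℚ] 1) * x) = b * LinearMap.mul' ℚ A x := by
    intro x
    induction x with
    | zero => simp
    | tmul u v => simp [mul_assoc]
    | add u v hu hv => simp [mul_add, hu, hv]
  simp [single, D.leibniz, h1, h2]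

theorem cyc_single_skew (a b : A) : cyc (D.single b a) = -cyc (D.single a b) := by
  have h : ∀ x : A ⊗[ℚ] A, cyc (LinearMap.mul' ℚ A (TensorProduct.comm ℚ A A x)) =
      cyc (LinearMap.mul' ℚ A x) := by
    intro x
    induction x with
    | zero => simp
    | tmul u v => simpa using cyc_mul_comm v u
    | add u v hu hv => simp only [map_add, hu, hv]
  simp [single, D.skew a b, h]

theorem cyc_single_right (a x : A) (hx : x ∈ commutators A) : cyc (D.single a x) = 0 := by
  have h : commutators A ≤ LinearMap.ker (cyc ∘ₗ D.single a) := by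
    refine Submodule.span_le.2 ?_
    rintro _ ⟨b, c, rfl⟩
    simp only [SetLike.mem_coe, LinearMap.mem_ker, LinearMap.comp_apply, map_sub, single_mul,
      map_add]
    rw [cyc_mul_comm (D.single a b) c, cyc_mul_comm b (D.single a c)]
    abel
  exact h hx

theorem cyc_single_left (x b : A) (hx : x ∈ commutators A) : cyc (D.single x b) = 0 := by
  rw [cyc_single_skew, cyc_single_right D b x hx, neg_zero]

/-- The induced bracket `⟨a, b⟩` on the cyclic space, characterised by
`⟨cyc a, cyc b⟩ = cyc {a, b}`. -/
def induced : CyclicSpace A →ₗ[ℚ] CyclicSpace A →ₗ[ℚ] CyclicSpace A :=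
  (commutators A).liftQ
    ((commutators A).liftQ (D.single.compr₂ cyc).flip (by
      intro x hx
      refine LinearMap.mem_ker.2 (LinearMap.ext fun a => ?_)
      exact D.cyc_single_right a x hx)).flip (by
    intro x hx
    refine LinearMap.mem_ker.2 (LinearMap.ext fun b => ?_)
    obtain ⟨b, rfl⟩ := (commutators A).mkQ_surjective b
    exact D.cyc_single_left x b hx)

theorem induced_cyc (a b : A) : D.induced (cyc a) (cyc b) = cyc (D.single a b) := rfl

end DoubleBracket

end DoubleBrackets

/-! ### Double brackets on noncommutative Laurent polynomials -/

/-- Noncommutative Laurent polynomials over `ℚ` in the variables `S`: finite linear combinations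
of reduced words in the letters `s` and `s⁻¹`. -/
abbrev NCLaurent (S : Type*) : Type _ := MonoidAlgebra ℚ (FreeGroup S)

section Construction

variable {S : Type*}

/-- The upper triangular invertible matrix with diagonal `x, y` and corner entry `m`. -/
def triUnit {T : Type*} [Ring T] (x y : Tˣ) (m : T) : (Matrix (Fin 2) (Fin 2) T)ˣ where
  val := !![(x : T), m; 0, (y : T)]
  inv := !![((x⁻¹ : Tˣ) : T), -(((x⁻¹ : Tˣ) : T) * m * ((y⁻¹ : Tˣ) : T)); 0, ((y⁻¹ : Tˣ) : T)]
  val_inv := by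
    ext i j
    fin_cases i <;> fin_cases j <;> simp [Matrix.mul_apply, Fin.sum_univ_two, ← mul_assoc]
  inv_val := by
    ext i j
    fin_cases i <;> fin_cases j <;> simp [Matrix.mul_apply, Fin.sum_univ_two, mul_assoc]

/-- The triangular representation of the free group whose corner entry is a freeDeration. -/
def triHom {T : Type*} [Ring T] (L R : FreeGroup S →* Tˣ) (c : S → T) :
    FreeGroup S →* (Matrix (Fin 2) (Fin 2) T)ˣ :=
  FreeGroup.lift fun s => triUnit (L (FreeGroup.of s)) (R (FreeGroup.of s)) (c s)

/-- The unique map `δ` on the free group with `δ s = c s` on generators and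
`δ (g h) = L g * δ h + δ g * R h`. -/
def freeDer {T : Type*} [Ring T] (L R : FreeGroup S →* Tˣ) (c : S → T) (g : FreeGroup S) : T :=
  (triHom L R c g : Matrix (Fin 2) (Fin 2) T) 0 1

section freeDer

variable {T : Type*} [Ring T] (L R : FreeGroup S →* Tˣ) (c : S → T)

theorem triHom_eq (g : FreeGroup S) : triHom L R c g = triUnit (L g) (R g) (freeDer L R c g) := by
  have key : ∀ g : FreeGroup S, (triHom L R c g : Matrix (Fin 2) (Fin 2) T) 0 0 = L g ∧
      (triHom L R c g : Matrix (Fin 2) (Fin 2) T) 1 0 = 0 ∧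
      (triHom L R c g : Matrix (Fin 2) (Fin 2) T) 1 1 = R g := by
    intro g
    induction g using FreeGroup.induction_on with
    | C1 => simp
    | of s => simp [triHom, triUnit]
    | inv_of s _ => simp [triHom, triUnit, Units.inv_mk]
    | mul x y hx hy => simp [Matrix.mul_apply, Fin.sum_univ_two, hx, hy]
  obtain ⟨h1, h2, h3⟩ := key g
  ext i j
  fin_cases i <;> fin_cases j <;> simp [triUnit, h1, h2, h3, freeDer]

@[simp] theorem freeDer_of (s : S) : freeDer L R c (FreeGroup.of s) = c s := by
  simp [freeDer, triHom, triUnit]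

theorem freeDer_mul (g h : FreeGroup S) :
    freeDer L R c (g * h) = L g * freeDer L R c h + freeDer L R c g * R h := by
  have h0 : freeDer L R c (g * h) =
      ((triHom L R c g * triHom L R c h : (Matrix (Fin 2) (Fin 2) T)ˣ) :
        Matrix (Fin 2) (Fin 2) T) 0 1 := by
    rw [← map_mul]; rfl
  rw [h0, triHom_eq, triHom_eq]
  simp [triUnit, Matrix.mul_apply, Fin.sum_univ_two]

@[simp] theorem freeDer_one : freeDer L R c 1 = 0 := by
  simp [freeDer]

theorem freeDer_inv (g : FreeGroup S) :
    freeDer L R c g⁻¹ = -(((L g)⁻¹ : Tˣ) * freeDer L R c g * ((R g)⁻¹ : Tˣ)) := by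
  have h := freeDer_mul L R c g g⁻¹
  rw [mul_inv_cancel, freeDer_one] at h
  have h2 : (L g : T) * freeDer L R c g⁻¹ = -(freeDer L R c g * ((R g)⁻¹ : Tˣ)) := by
    rw [eq_neg_iff_add_eq_zero, ← map_inv]; exact h.symm
  rw [mul_assoc, ← mul_neg, ← h2, ← mul_assoc]
  simp

/-- Two maps with the product rule of a freeDeration that agree on generators are equal. -/
theorem freeDer_unique {f : FreeGroup S → T}
    (hf : ∀ g h, f (g * h) = L g * f h + f g * R h) (hc : ∀ s, f (FreeGroup.of s) = c s) :
    f = freeDer L R c := by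
  have f1 : f 1 = 0 := by simpa using hf 1 1
  funext g
  induction g using FreeGroup.induction_on with
  | C1 => simp [f1]
  | of s => simp [hc]
  | inv_of s hs =>
    have h := hf (FreeGroup.of s) (FreeGroup.of s)⁻¹
    rw [mul_inv_cancel, f1, hs] at h
    have h' := freeDer_mul L R c (FreeGroup.of s) (FreeGroup.of s)⁻¹
    rw [mul_inv_cancel, freeDer_one] at h'
    have h2 := h.symm.trans h'
    exact (Units.mul_right_inj _).1 (add_right_cancel h2)
  | mul x y hx hy => rw [hf, hx, hy, freeDer_mul]

end freeDer

/-- `g ↦ g ⊗ 1`. -/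
def leftUnit : FreeGroup S →* (NCLaurent S ⊗[ℚ] NCLaurent S)ˣ :=
  MonoidHom.toHomUnits
    ((Algebra.TensorProduct.includeLeft (R := ℚ) (S := ℚ) (A := NCLaurent S)
      (B := NCLaurent S)).toMonoidHom.comp (MonoidAlgebra.of ℚ (FreeGroup S)))

/-- `g ↦ 1 ⊗ g`. -/
def rightUnit : FreeGroup S →* (NCLaurent S ⊗[ℚ] NCLaurent S)ˣ :=
  MonoidHom.toHomUnits
    ((Algebra.TensorProduct.includeRight (R := ℚ) (A := NCLaurent S)
      (B := NCLaurent S)).toMonoidHom.comp (MonoidAlgebra.of ℚ (FreeGroup S)))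

@[simp] theorem leftUnit_val (g : FreeGroup S) :
    (leftUnit g : NCLaurent S ⊗[ℚ] NCLaurent S) = MonoidAlgebra.of ℚ _ g ⊗ₜ[ℚ] 1 := rfl

@[simp] theorem rightUnit_val (g : FreeGroup S) :
    (rightUnit g : NCLaurent S ⊗[ℚ] NCLaurent S) = 1 ⊗ₜ[ℚ] MonoidAlgebra.of ℚ _ g := rfl

/-- The bracket of two group elements, determined by the values `c s t` on generators by the
product rules `⟪f, g h⟫ = ⟪f, g⟫ (1 ⊗ h) + (g ⊗ 1) ⟪f, h⟫` and
`⟪f g, h⟫ = (1 ⊗ f) ⟪g, h⟫ + ⟪f, h⟫ (g ⊗ 1)`. -/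
def groupBracket (c : S → S → NCLaurent S ⊗[ℚ] NCLaurent S) (g h : FreeGroup S) :
    NCLaurent S ⊗[ℚ] NCLaurent S :=
  freeDer rightUnit leftUnit (fun s => freeDer leftUnit rightUnit (c s) h) g

variable (c : S → S → NCLaurent S ⊗[ℚ] NCLaurent S)

theorem groupBracket_of (s t : S) :
    groupBracket c (FreeGroup.of s) (FreeGroup.of t) = c s t := by
  simp [groupBracket]

theorem groupBracket_mul_left (f g h : FreeGroup S) :
    groupBracket c (f * g) h =
      rightUnit f * groupBracket c g h + groupBracket c f h * leftUnit g :=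
  freeDer_mul _ _ _ _ _

theorem leftUnit_mul_rightUnit (g h : FreeGroup S) :
    (leftUnit g : NCLaurent S ⊗[ℚ] NCLaurent S) * rightUnit h = rightUnit h * leftUnit g := by
  simp

theorem groupBracket_mul_right (f g h : FreeGroup S) :
    groupBracket c f (g * h) =
      leftUnit g * groupBracket c f h + groupBracket c f g * rightUnit h := by
  have key := freeDer_unique (rightUnit (S := S)) leftUnit
    (fun s => freeDer leftUnit rightUnit (c s) (g * h))
    (f := fun f => leftUnit g * groupBracket c f h + groupBracket c f g * rightUnit h)
    (by
      intro a b
      simp only [groupBracket_mul_left, mul_add, add_mul]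
      have e1 : (leftUnit g : NCLaurent S ⊗[ℚ] NCLaurent S) *
          (rightUnit a * groupBracket c b h) = rightUnit a * (leftUnit g * groupBracket c b h) := by
        rw [← mul_assoc, leftUnit_mul_rightUnit, mul_assoc]
      have e2 : groupBracket c a g * (leftUnit b : NCLaurent S ⊗[ℚ] NCLaurent S) * rightUnit h =
          groupBracket c a g * rightUnit h * leftUnit b := by
        rw [mul_assoc, leftUnit_mul_rightUnit, mul_assoc]
      rw [e1, e2]
      simp only [mul_assoc]
      abel)
    (by
      intro s
      simp [groupBracket, freeDer_mul])
  exact (congrFun key f).symm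

theorem comm_mul {A : Type*} [Ring A] [Algebra ℚ A] (x y : A ⊗[ℚ] A) :
    TensorProduct.comm ℚ A A (x * y) = TensorProduct.comm ℚ A A x * TensorProduct.comm ℚ A A y :=
  map_mul (Algebra.TensorProduct.comm ℚ A A) x y

theorem tensor_mul_neg {A : Type*} [Ring A] [Algebra ℚ A] (x y : A ⊗[ℚ] A) :
    x * -y = -(x * y) := map_neg (LinearMap.mulLeft ℚ x) y

theorem tensor_neg_mul {A : Type*} [Ring A] [Algebra ℚ A] (x y : A ⊗[ℚ] A) :
    -x * y = -(x * y) := map_neg (LinearMap.mulRight ℚ y) x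

theorem groupBracket_skew (hc : ∀ s t, c t s = -TensorProduct.comm ℚ _ _ (c s t))
    (g h : FreeGroup S) :
    groupBracket c h g = -TensorProduct.comm ℚ _ _ (groupBracket c g h) := by
  have step : ∀ s h, freeDer leftUnit rightUnit (c s) h =
      -TensorProduct.comm ℚ _ _ (groupBracket c h (FreeGroup.of s)) := by
    intro s h
    refine (congrFun (freeDer_unique (leftUnit (S := S)) rightUnit (c s)
      (f := fun h => -TensorProduct.comm ℚ _ _ (groupBracket c h (FreeGroup.of s)))
      ?_ ?_) h).symm
    · intro a b
      simp only [groupBracket_mul_left, map_add, comm_mul]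
      simp only [rightUnit_val, leftUnit_val, TensorProduct.comm_tmul]
      rw [neg_add, tensor_mul_neg, tensor_neg_mul, add_comm]
    · intro t
      rw [groupBracket_of, ← hc]
  refine (congrFun (freeDer_unique (rightUnit (S := S)) leftUnit
    (fun s => freeDer leftUnit rightUnit (c s) g)
    (f := fun h => -TensorProduct.comm ℚ _ _ (groupBracket c g h)) ?_ ?_) h).symm
  · intro a b
    simp only [groupBracket_mul_right, map_add, comm_mul]
    simp only [rightUnit_val, leftUnit_val, TensorProduct.comm_tmul]
    rw [neg_add, tensor_mul_neg, tensor_neg_mul, add_comm]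
  · intro s
    exact (step s g).symm

/-- Linear extension of a map on the free group to Laurent polynomials. -/
def linExt {M : Type*} [AddCommGroup M] [Module ℚ M] :
    (FreeGroup S → M) →ₗ[ℚ] NCLaurent S →ₗ[ℚ] M where
  toFun φ := Finsupp.linearCombination ℚ φ ∘ₗ (MonoidAlgebra.coeffLinearEquiv ℚ).toLinearMap
  map_add' φ ψ := by
    ext g
    simp [MonoidAlgebra.coeffLinearEquiv]
  map_smul' r φ := by
    ext g
    simp [MonoidAlgebra.coeffLinearEquiv]

@[simp] theorem linExt_of {M : Type*} [AddCommGroup M] [Module ℚ M] (φ : FreeGroup S → M)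
    (g : FreeGroup S) : linExt φ (MonoidAlgebra.of ℚ _ g) = φ g := by
  simp [linExt, MonoidAlgebra.coeffLinearEquiv]

/-- A property of Laurent polynomials closed under linear combinations holds if it holds for
group elements. -/
theorem NCLaurent.induction {p : NCLaurent S → Prop}
    (h1 : ∀ g, p (MonoidAlgebra.of ℚ _ g)) (h2 : ∀ a b, p a → p b → p (a + b))
    (h3 : ∀ (r : ℚ) a, p a → p (r • a)) (a : NCLaurent S) : p a :=
  MonoidAlgebra.induction_on a h1 h2 h3

/-- The double bracket on noncommutative Laurent polynomials with prescribed values on pairs of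
generators. -/
def DoubleBracket.ofGenerators (c : S → S → NCLaurent S ⊗[ℚ] NCLaurent S)
    (hc : ∀ s t, c t s = -TensorProduct.comm ℚ _ _ (c s t)) : DoubleBracket (NCLaurent S) where
  db := linExt fun g => linExt (groupBracket c g)
  leibniz := by
    intro a b b'
    induction a using NCLaurent.induction with
    | h2 x y hx hy => simp only [map_add, LinearMap.add_apply, hx, hy, add_mul, mul_add]; abel
    | h3 r x hx =>
      simp only [map_smul, LinearMap.smul_apply, hx, smul_add, smul_mul_assoc, mul_smul_comm]
    | h1 f =>
    induction b using NCLaurent.induction with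
    | h2 x y hx hy =>
      simp only [map_add, add_mul, TensorProduct.add_tmul, hx, hy]; abel
    | h3 r x hx =>
      simp only [map_smul, smul_mul_assoc, hx, smul_add]
      simp only [← TensorProduct.smul_tmul', smul_mul_assoc]
    | h1 g =>
    induction b' using NCLaurent.induction with
    | h2 x y hx hy =>
      simp only [map_add, mul_add, TensorProduct.tmul_add, hx, hy]; abel
    | h3 r x hx =>
      simp only [map_smul, mul_smul_comm, hx, smul_add, TensorProduct.tmul_smul]
    | h1 h =>
    rw [← map_mul]
    simp only [linExt_of, groupBracket_mul_right]
    rw [add_comm]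
    rfl
  skew := by
    intro a b
    induction a using NCLaurent.induction with
    | h2 x y hx hy => simp only [map_add, LinearMap.add_apply, hx, hy, neg_add]
    | h3 r x hx => simp only [map_smul, LinearMap.smul_apply, hx, smul_neg]
    | h1 f =>
    induction b using NCLaurent.induction with
    | h2 x y hx hy => simp only [map_add, LinearMap.add_apply, hx, hy, neg_add]
    | h3 r x hx => simp only [map_smul, LinearMap.smul_apply, hx, smul_neg]
    | h1 g => simpa only [linExt_of] using groupBracket_skew c hc f g

theorem DoubleBracket.ofGenerators_of (c : S → S → NCLaurent S ⊗[ℚ] NCLaurent S)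
    (hc : ∀ s t, c t s = -TensorProduct.comm ℚ _ _ (c s t)) (s t : S) :
    (DoubleBracket.ofGenerators c hc).db (MonoidAlgebra.of ℚ _ (FreeGroup.of s))
      (MonoidAlgebra.of ℚ _ (FreeGroup.of t)) = c s t := by
  simp only [ofGenerators, linExt_of, groupBracket_of]

end Construction

/-! ### Acyclic networks and boundary measurements -/

/-- An acyclic directed network with finitely many edges, with sources and sinks labelled by `I`
and edge weights in `R`. Acyclicity is expressed by a height function on the vertices which
strictly increases along every edge. -/
structure Network (V E I R : Type*) where
  src : E → V
  tgt : E → V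
  source : I → V
  sink : I → V
  weight : E → R
  acyclic : ∃ height : V → ℕ, ∀ e, height (src e) < height (tgt e)

namespace Network

variable {V E I R : Type*}

/-- `N.IsPath u p v`: the list of edges `p` is a directed path from `u` to `v`. -/
def IsPath (N : Network V E I R) : V → List E → V → Prop
  | u, [], v => u = v
  | u, e :: p, v => N.src e = u ∧ IsPath N (N.tgt e) p v

theorem finite_paths [Finite E] (N : Network V E I R) (u v : V) :
    {p : List E | N.IsPath u p v}.Finite := by
  obtain ⟨height, hh⟩ := N.acyclic
  have key : ∀ (p : List E) (u : V), N.IsPath u p v → p.length + height u ≤ height v := by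
    intro p
    induction p with
    | nil => rintro u rfl; simp
    | cons e p ih =>
      rintro u ⟨rfl, hp⟩
      have := ih _ hp
      have := hh e
      simp only [List.length_cons]
      omega
  refine (List.finite_length_le E (height v)).subset fun p hp => ?_
  have h := key p u hp
  exact (Nat.le_add_right _ _).trans h

/-- The weight of a path: the product of the weights of its edges, in order. -/
def pathWeight [Monoid R] (N : Network V E I R) (p : List E) : R := (p.map N.weight).prod

/-- The boundary measurement matrix: the `(i, j)` entry is the sum of the weights of all directed
paths from source `i` to sink `j`. -/
def boundaryMeasurement [Finite E] [Semiring R] (N : Network V E I R) : Matrix I I R :=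
  Matrix.of fun i j => ∑ p ∈ (N.finite_paths (N.source i) (N.sink j)).toFinset, N.pathWeight p

end Network

/-! ### The edges of the toric pentagram network and the double bracket -/

/-- The six families of edges of the pentagram network on the torus. For the `i`-th square face:
* `left` goes from its bottom left to its top left corner,
* `bottom` goes from its bottom left to its bottom right corner,
* `right` goes from its top right to its bottom right corner,
* `top` goes from its top left to its top right corner,
* `white` goes from its top right corner to the bottom left corner of square `i + 2`,
* `black` goes from its bottom right corner to the top left corner of square `i + 1`.
Top right and bottom left corners are white, top left and bottom right corners are black. -/
inductive EdgeKind
  | left | bottom | right | top | white | black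
  deriving DecidableEq

instance : Fintype EdgeKind where
  elems := {.left, .bottom, .right, .top, .white, .black}
  complete := by intro k; cases k <;> decide

/-- The edges of the pentagram network on the torus, with squares indexed by `ZMod n`. -/
abbrev Edge (n : ℕ) : Type := EdgeKind × ZMod n

/-- The algebra of noncommutative Laurent polynomials in the edge weights. -/
abbrev EdgeAlgebra (n : ℕ) : Type := NCLaurent (Edge n)

/-- An edge as a generator of the free group. -/
def edge {n : ℕ} (k : EdgeKind) (i : ZMod n) : FreeGroup (Edge n) := FreeGroup.of (k, i)

/-- A Laurent monomial as an element of the algebra. -/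
abbrev mono {n : ℕ} (g : FreeGroup (Edge n)) : EdgeAlgebra n := MonoidAlgebra.of ℚ _ g

/-- `e ⊗ f` for two edges. -/
def pureTensor {n : ℕ} (e f : Edge n) : EdgeAlgebra n ⊗[ℚ] EdgeAlgebra n :=
  mono (FreeGroup.of e) ⊗ₜ[ℚ] mono (FreeGroup.of f)

/-- The double bracket of two edges, up to the factor `1 / 2`. At a white vertex with incoming
edge `x` and outgoing edges `y, z` in counterclockwise order from `x`, the only nonzero brackets
are `⟪y, z⟫ = (1 / 2) y ⊗ z` and its opposite; at a black vertex with outgoing edge `a` and incoming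
edges `b, c` in clockwise order from `a`, they are `⟪b, c⟫ = (1 / 2) c ⊗ b` and its opposite. -/
def edgeBracketAux {n : ℕ} : Edge n → Edge n → EdgeAlgebra n ⊗[ℚ] EdgeAlgebra n
  -- the bottom left corner of square `i`, white, `y = bottom i`, `z = left i`
  | (.bottom, i), (.left, j) => if i = j then pureTensor (.bottom, i) (.left, i) else 0
  | (.left, j), (.bottom, i) => if i = j then -pureTensor (.left, i) (.bottom, i) else 0
  -- the top right corner of square `i`, white, `y = right i`, `z = white i`
  | (.right, i), (.white, j) => if i = j then pureTensor (.right, i) (.white, i) else 0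
  | (.white, j), (.right, i) => if i = j then -pureTensor (.white, i) (.right, i) else 0
  -- the bottom right corner of square `i`, black, `b = bottom i`, `c = right i`
  | (.bottom, i), (.right, j) => if i = j then pureTensor (.right, i) (.bottom, i) else 0
  | (.right, j), (.bottom, i) => if i = j then -pureTensor (.bottom, i) (.right, i) else 0
  -- the top left corner of square `i`, black, `b = left i`, `c = black (i - 1)`
  | (.left, i), (.black, j) =>
      if i = j + 1 then pureTensor (.black, j) (.left, i) else 0
  | (.black, j), (.left, i) =>
      if i = j + 1 then -pureTensor (.left, i) (.black, j) else 0
  | _, _ => 0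

/-- The double bracket of two edges. -/
def edgeBracket {n : ℕ} (e f : Edge n) : EdgeAlgebra n ⊗[ℚ] EdgeAlgebra n :=
  (1 / 2 : ℚ) • edgeBracketAux e f

theorem edgeBracket_skew {n : ℕ} (e f : Edge n) :
    edgeBracket f e = -TensorProduct.comm ℚ _ _ (edgeBracket e f) := by
  obtain ⟨k, i⟩ := e
  obtain ⟨m, j⟩ := f
  cases k <;> cases m <;>
    simp only [edgeBracket, edgeBracketAux, map_smul, apply_ite (TensorProduct.comm ℚ _ _),
      map_zero, map_neg, smul_zero, neg_zero, pureTensor, TensorProduct.comm_tmul] <;>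
    (try split_ifs) <;> simp_all

/-- The double bracket on the algebra of Laurent polynomials in the edge weights of the
pentagram network. -/
def pentagramBracket (n : ℕ) : DoubleBracket (EdgeAlgebra n) :=
  DoubleBracket.ofGenerators edgeBracket edgeBracket_skew

/-! ### The loops `X`, `Y`, `Z` -/

section Loops

variable {n : ℕ}

/-- `a i`, from the bottom left corner of square `i` to the bottom right corner of square `i - 1`
(which is joined by an edge to the top left corner of square `i`). -/
def a (i : ZMod n) : FreeGroup (Edge n) := edge .left i * (edge .black (i - 1))⁻¹

/-- `b i`, the bottom edge of square `i`. -/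
def b (i : ZMod n) : FreeGroup (Edge n) := edge .bottom i

/-- `c i`, the right side of square `i`, starting from the other end of the edge `white i`. -/
def c (i : ZMod n) : FreeGroup (Edge n) := (edge .white i)⁻¹ * edge .right i

/-- `d i`, the top of square `i`, with its two adjacent edges. -/
def d (i : ZMod n) : FreeGroup (Edge n) := edge .black (i - 1) * edge .top i * edge .white i

/-- The staircase path `d 0 * c 0 * d 1 * c 1 * ⋯ * d (k - 1) * c (k - 1)` from the base point to
square `k`; the base point is the start of the edge `black (-1)` entering the top left corner of
square `0`. -/
def stair (n : ℕ) : ℕ → FreeGroup (Edge n)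
  | 0 => 1
  | k + 1 => stair n k * (d (k : ZMod n) * c (k : ZMod n))

/-- The path from the base point to the start of the loops `xLoop i` and `yLoop i`: follow the
staircase up to square `i` and go back by `c (i-1)`, `d (i-1)`, `c (i-2)`. For `2 ≤ i` it equals
`d 0 * c 0 * ⋯ * d (i - 3) * c (i - 3) * d (i - 2)`. -/
def access (n i : ℕ) : FreeGroup (Edge n) :=
  stair n i * (c ((i : ZMod n) - 1))⁻¹ * (d ((i : ZMod n) - 1))⁻¹ * (c ((i : ZMod n) - 2))⁻¹

/-- The loop `x i = a i (c (i-1))⁻¹ (d (i-1))⁻¹ (c (i-2))⁻¹`. -/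
def xLoop (i : ZMod n) : FreeGroup (Edge n) :=
  a i * (c (i - 1))⁻¹ * (d (i - 1))⁻¹ * (c (i - 2))⁻¹

/-- The loop `y i = b i (c i)⁻¹ (d i)⁻¹ (c (i-1))⁻¹ (d (i-1))⁻¹ (c (i-2))⁻¹`. -/
def yLoop (i : ZMod n) : FreeGroup (Edge n) :=
  b i * (c i)⁻¹ * (d i)⁻¹ * (c (i - 1))⁻¹ * (d (i - 1))⁻¹ * (c (i - 2))⁻¹

/-- The based loop `X i`, for the squares `i = 0, …, n - 1`. -/
def X (n i : ℕ) : FreeGroup (Edge n) := access n i * xLoop (i : ZMod n) * (access n i)⁻¹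

/-- The based loop `Y i`, for the squares `i = 0, …, n - 1`. -/
def Y (n i : ℕ) : FreeGroup (Edge n) := access n i * yLoop (i : ZMod n) * (access n i)⁻¹

/-- The based loop `Z`, which runs along the whole staircase. -/
def Z (n : ℕ) : FreeGroup (Edge n) := stair n n

end Loops

/-! ### The network on the cylinder and the invariants -/

/-- The corners of a square face. -/
inductive Corner
  | topLeft | topRight | bottomLeft | bottomRight

/-- The vertices of the network on the cylinder. -/
inductive Vertex (n : ℕ)
  | source (s : Fin 3)
  | corner (p : Corner) (i : Fin n)
  | sink (s : Fin 3)

/-- The edges of the network on the cylinder: one edge at every source, and six families of edges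
indexed by the square faces. -/
abbrev CylinderEdge (n : ℕ) : Type := Fin 3 ⊕ (EdgeKind × Fin n)

/-- The vertex reached by the edge which leads to the top left corner of square `k`; for `k = n`
the edge ends on the outer boundary, at the sink with label `1`. (Labels `1, 2, 3` are the elements
`0, 1, 2` of `Fin 3`.) -/
def toTopLeft (n k : ℕ) : Vertex n :=
  if h : k < n then .corner .topLeft ⟨k, h⟩ else .sink 0

/-- The vertex reached by the edge which leads to the bottom left corner of square `k`; for `k = n`
and `k = n + 1` the edge ends on the outer boundary, at the sinks with labels `2` and `3`. -/
def toBottomLeft (n k : ℕ) : Vertex n :=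
  if h : k < n then .corner .bottomLeft ⟨k, h⟩ else if k = n then .sink 1 else .sink 2

/-- The start of an edge of the cylinder network. -/
def cylinderSrc {n : ℕ} : CylinderEdge n → Vertex n
  | .inl s => .source s
  | .inr (.left, i) => .corner .bottomLeft i
  | .inr (.bottom, i) => .corner .bottomLeft i
  | .inr (.right, i) => .corner .topRight i
  | .inr (.top, i) => .corner .topLeft i
  | .inr (.white, i) => .corner .topRight i
  | .inr (.black, i) => .corner .bottomRight i

/-- The end of an edge of the cylinder network. The sources `1, 2, 3` are the starts of the edges
leading to the top left corner of square `0` and to the bottom left corners of squares `0`, `1`. -/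
def cylinderTgt {n : ℕ} : CylinderEdge n → Vertex n
  | .inl s => if s = 0 then toTopLeft n 0 else if s = 1 then toBottomLeft n 0 else toBottomLeft n 1
  | .inr (.left, i) => .corner .topLeft i
  | .inr (.bottom, i) => .corner .bottomRight i
  | .inr (.right, i) => .corner .bottomRight i
  | .inr (.top, i) => .corner .topRight i
  | .inr (.white, i) => toBottomLeft n (i + 2)
  | .inr (.black, i) => toTopLeft n (i + 1)

/-- The edge weights in the algebra: `X i` on the left and `Y i` on the bottom edge of each square,
`Z` on each of the edges which end at a sink, and `1` on all other edges. -/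
def cylinderMonomial {n : ℕ} (e : CylinderEdge n) : FreeGroup (Edge n) :=
  (match e with
    | .inr (.left, i) => X n i
    | .inr (.bottom, i) => Y n i
    | _ => 1) *
  (match cylinderTgt e with
    | .sink _ => Z n
    | _ => 1)

/-- The number of crossings of an edge with the cut. The cut crosses every edge joining two white
vertices once, just after the edge leaves the top right corner of a square. -/
def cutCrossing {n : ℕ} : CylinderEdge n → ℤ
  | .inr (.white, _) => 1
  | _ => 0

/-- The height of a vertex, increasing along all edges. -/
def vertexHeight {n : ℕ} : Vertex n → ℕ
  | .source _ => 0
  | .corner .bottomLeft i => 4 * i + 1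
  | .corner .topLeft i => 4 * i + 2
  | .corner .topRight i => 4 * i + 3
  | .corner .bottomRight i => 4 * i + 4
  | .sink _ => 4 * n + 1

theorem vertexHeight_lt {n : ℕ} (e : CylinderEdge n) :
    vertexHeight (cylinderSrc e) < vertexHeight (cylinderTgt e) := by
  have h1 : ∀ k m, m ≤ 4 * n → m < 4 * k + 2 → m < vertexHeight (toTopLeft n k) := by
    intro k m h h'
    unfold toTopLeft
    split_ifs <;> simp only [vertexHeight] <;> omega
  have h2 : ∀ k m, m ≤ 4 * n → m < 4 * k + 1 → m < vertexHeight (toBottomLeft n k) := by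
    intro k m h h'
    unfold toBottomLeft
    split_ifs <;> simp only [vertexHeight] <;> omega
  rcases e with s | ⟨k, i⟩
  · simp only [cylinderSrc, cylinderTgt, vertexHeight]
    split_ifs
    · exact h1 _ _ (by omega) (by omega)
    · exact h2 _ _ (by omega) (by omega)
    · exact h2 _ _ (by omega) (by omega)
  · have hi := i.isLt
    cases k <;> simp only [cylinderSrc, cylinderTgt, vertexHeight]
    · omega
    · omega
    · omega
    · omega
    · exact h2 _ _ (by omega) (by omega)
    · exact h1 _ _ (by omega) (by omega)

/-- The pentagram network on the cylinder, with weights modified by the variable `λ` of the ring of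
Laurent polynomials (denoted `T` in Mathlib) according to the crossings with the cut. -/
def pentagramNetwork (n : ℕ) :
    Network (Vertex n) (CylinderEdge n) (Fin 3) (LaurentPolynomial (EdgeAlgebra n)) where
  src := cylinderSrc
  tgt := cylinderTgt
  source := .source
  sink := .sink
  weight e := LaurentPolynomial.C (mono (cylinderMonomial e)) * LaurentPolynomial.T (cutCrossing e)
  acyclic := ⟨vertexHeight, vertexHeight_lt⟩

/-- The boundary measurement matrix `B(λ)` of the pentagram network. -/
def boundaryMatrix (n : ℕ) : Matrix (Fin 3) (Fin 3) (LaurentPolynomial (EdgeAlgebra n)) :=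
  (pentagramNetwork n).boundaryMeasurement

/-- The invariant `t i k`: the coefficient of `λ ^ k` in the trace of `B(λ) ^ i`. -/
def invariant (n i : ℕ) (k : ℤ) : EdgeAlgebra n :=
  (Matrix.trace (boundaryMatrix n ^ i)).coeff k

end GrassmannPentagram

end

noncomputable section

namespace GrassmannPentagram

/-! ### Cyclic contractions and derivatives of traces -/

section Sandwich

variable {A : Type*} [Ring A] [Algebra ℚ A]

/-! The proof is the classical `r`-matrix argument, carried out with double brackets. Replace the
central variable `λ` by a nonzero rational number `x`. Up to conjugation by a diagonal matrix of
Laurent monomials, the boundary measurement matrix becomes an ordered product of `3 × 3` transfer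
matrices, one for each square, whose entries involve the original edges instead of the loops `X`,
`Y`, `Z` (`boundaryMatrix_map_evalAt`). This uses that `X k` and `Y k` are parallel transports of
pieces of the square `k` to the base point, and that `Z` is the monodromy of the gauge after one
turn around the torus.

For distinct `x` and `y`, the transfer matrices of one square at `x` and `y` satisfy a trigonometric
`r`-matrix relation (`squareMatrix_relation`). Edges belonging to different squares have zero
bracket, and the relation passes to products of independent factors (`RMatrixRelation.mul`). Hence
it holds for the whole strip (`stripMatrix_relation`).

The relation forces the induced bracket of traces of powers to vanish (`RMatrixRelation.trace_pow`).
Modulo commutators, the bracket of two traces contracts the brackets of entries with the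
complementary powers, as for commutative Poisson brackets. The two terms of the `r`-matrix then
carry opposite coefficients.

Conjugation does not change traces modulo commutators, so the traces of powers of the boundary
measurement matrix at `x` and at `y` have zero bracket whenever `x ≠ y`. A Laurent polynomial with
infinitely many zeros vanishes, which gives the statement for all coefficients
(`coeff_pairing_eq_zero`). -/

/-- The linear map `u ⊗ v ↦ cyc (u f v g)`. -/
def sandwich (f g : A) : A ⊗[ℚ] A →ₗ[ℚ] CyclicSpace A :=
  cyc ∘ₗ LinearMap.mulRight ℚ g ∘ₗ LinearMap.mul' ℚ A ∘ₗ
    TensorProduct.map (LinearMap.mulRight ℚ f) LinearMap.id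

@[simp] theorem sandwich_tmul (f g u v : A) : sandwich f g (u ⊗ₜ v) = cyc (u * f * v * g) := by
  simp [sandwich]

/-- In the cyclic word `u f v g`, the letter `g` fills the outer gap and `f` the inner gap of `u ⊗
v`. This and the next three lemmas absorb multiplication for the outer bimodule structure (Leibniz
rule in the second argument) into `g`, and for the inner one (first argument) into `f`. -/
theorem sandwich_mul_one_tmul (f g c : A) (x : A ⊗[ℚ] A) :
    sandwich f g (x * (1 ⊗ₜ c)) = sandwich f (c * g) x := by
  induction x with
  | zero => simp
  | tmul u v => simp [mul_assoc]
  | add u v hu hv => simp only [add_mul, map_add, hu, hv]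

theorem sandwich_tmul_one_mul (f g c : A) (x : A ⊗[ℚ] A) :
    sandwich f g ((c ⊗ₜ 1) * x) = sandwich f (g * c) x := by
  induction x with
  | zero => simp
  | tmul u v =>
    simp only [Algebra.TensorProduct.tmul_mul_tmul, one_mul, sandwich_tmul]
    rw [mul_assoc c u, mul_assoc c, mul_assoc c, cyc_mul_comm, mul_assoc _ g c]
  | add u v hu hv => simp only [mul_add, map_add, hu, hv]

theorem sandwich_mul_tmul_one (f g c : A) (x : A ⊗[ℚ] A) :
    sandwich f g (x * (c ⊗ₜ 1)) = sandwich (c * f) g x := by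
  induction x with
  | zero => simp
  | tmul u v => simp [mul_assoc]
  | add u v hu hv => simp only [add_mul, map_add, hu, hv]

theorem sandwich_one_tmul_mul (f g c : A) (x : A ⊗[ℚ] A) :
    sandwich f g ((1 ⊗ₜ c) * x) = sandwich (f * c) g x := by
  induction x with
  | zero => simp
  | tmul u v => simp [mul_assoc]
  | add u v hu hv => simp only [mul_add, map_add, hu, hv]

theorem sandwich_sum_left {ι : Type*} (s : Finset ι) (f : ι → A) (g : A) (x : A ⊗[ℚ] A) :
    sandwich (∑ i ∈ s, f i) g x = ∑ i ∈ s, sandwich (f i) g x := by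
  induction x with
  | zero => simp
  | tmul u v => simp [Finset.mul_sum, Finset.sum_mul]
  | add u v hu hv => simp only [map_add, hu, hv, Finset.sum_add_distrib]

theorem sandwich_sum_right {ι : Type*} (s : Finset ι) (f : A) (g : ι → A) (x : A ⊗[ℚ] A) :
    sandwich f (∑ i ∈ s, g i) x = ∑ i ∈ s, sandwich f (g i) x := by
  induction x with
  | zero => simp
  | tmul u v => simp [Finset.mul_sum]
  | add u v hu hv => simp only [map_add, hu, hv, Finset.sum_add_distrib]

theorem sandwich_one_one (x : A ⊗[ℚ] A) : sandwich 1 1 x = cyc (LinearMap.mul' ℚ A x) := by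
  simp [sandwich]

end Sandwich

section CyclicDerivation

variable {A M ι : Type*} [Ring A] [AddCommMonoid M] [Fintype ι] [DecidableEq ι]

/-- A biadditive map `Φ` with `Φ (f g) h = Φ f (g h) + Φ g (h f)` behaves on traces of powers like
a derivation on a commutative algebra. -/
theorem cyclicDerivation_pow (Φ : A → A → M)
    (hl : ∀ (f : ι → A) h, Φ (∑ i, f i) h = ∑ i, Φ (f i) h)
    (hr : ∀ f (h : ι → A), Φ f (∑ i, h i) = ∑ i, Φ f (h i))
    (hΦ : ∀ f g h, Φ (f * g) h = Φ f (g * h) + Φ g (h * f)) (U : Matrix ι ι A) (i m : ℕ) :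
    ∑ p, ∑ q, Φ ((U ^ (i + 1)) p q) ((U ^ m) q p) =
      (i + 1) • ∑ p, ∑ q, Φ (U p q) ((U ^ (i + m)) q p) := by
  induction i generalizing m with
  | zero => simp
  | succ i ih =>
    -- Split the last factor off the power in the first argument. The remaining power keeps its slot
    -- while the exponent `m` grows by one, which is why `m` is general in the induction; the
    -- split-off factor contributes one more copy of the final sum.
    have h1 : ∑ p, ∑ q, Φ ((U ^ (i + 1 + 1)) p q) ((U ^ m) q p) =
        ∑ p, ∑ r, Φ ((U ^ (i + 1)) p r) ((U ^ (m + 1)) r p) +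
        ∑ r, ∑ q, Φ (U r q) ((U ^ (i + 1 + m)) q r) := by
      have e1 : ∀ p r, Φ ((U ^ (i + 1)) p r) ((U ^ (m + 1)) r p) =
          ∑ q, Φ ((U ^ (i + 1)) p r) (U r q * (U ^ m) q p) := by
        intro p r
        rw [pow_succ' U m, Matrix.mul_apply, hr]
      have e2 : ∀ r q, Φ (U r q) ((U ^ (i + 1 + m)) q r) =
          ∑ p, Φ (U r q) ((U ^ m) q p * (U ^ (i + 1)) p r) := by
        intro r q
        rw [add_comm (i + 1) m, pow_add, Matrix.mul_apply, hr]
      simp only [e1, e2]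
      simp only [pow_succ U (i + 1), Matrix.mul_apply, hl, hΦ, Finset.sum_add_distrib]
      congr 1
      · exact Finset.sum_congr rfl fun p _ => Finset.sum_comm
      · rw [Finset.sum_comm_cycle]
        exact Finset.sum_congr rfl fun z _ => Finset.sum_comm
    rw [h1, ih, succ_nsmul _ (i + 1), show i + (m + 1) = i + 1 + m by omega]

theorem cyclicDerivation_trace (Φ : A → A → M)
    (hl : ∀ (f : ι → A) h, Φ (∑ i, f i) h = ∑ i, Φ (f i) h)
    (hr : ∀ f (h : ι → A), Φ f (∑ i, h i) = ∑ i, Φ f (h i))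
    (h0 : ∀ f, Φ f 0 = 0)
    (hΦ : ∀ f g h, Φ (f * g) h = Φ f (g * h) + Φ g (h * f)) (U : Matrix ι ι A) (i : ℕ) :
    Φ (Matrix.trace (U ^ (i + 1))) 1 = (i + 1) • ∑ p, ∑ q, Φ (U p q) ((U ^ i) q p) := by
  have := cyclicDerivation_pow Φ hl hr hΦ U i 0
  rw [add_zero] at this
  rw [← this, Matrix.trace, hl]
  refine Finset.sum_congr rfl fun p _ => ?_
  rw [Finset.sum_eq_single p]
  · simp
  · intro q _ hq
    simp [Matrix.one_apply_ne hq, h0]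
  · simp

end CyclicDerivation

/-! ### The `r`-matrix relation and its consequences -/

namespace DoubleBracket

variable {A : Type*} [Ring A] [Algebra ℚ A] (D : DoubleBracket A)

theorem leibniz_left (a b c : A) :
    D.db (a * b) c = (1 ⊗ₜ[ℚ] a) * D.db b c + D.db a c * (b ⊗ₜ[ℚ] 1) := by
  rw [D.skew c (a * b), D.leibniz, map_add, comm_mul, comm_mul, D.skew c b, D.skew c a]
  simp only [TensorProduct.comm_tmul]
  rw [tensor_mul_neg, tensor_neg_mul]
  abel

theorem db_one_right (a : A) : D.db a 1 = 0 := by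
  have h := D.leibniz a 1 1
  rw [mul_one, ← Algebra.TensorProduct.one_def, mul_one, one_mul] at h
  exact left_eq_add.1 h

theorem db_one_left (a : A) : D.db 1 a = 0 := by
  rw [D.skew a 1, db_one_right]
  simp

/-- The double brackets of entries of the matrices `U` and `V` are given by the `r`-matrix whose
skew-symmetric part has the coefficients `σ s u` and whose symmetric part is `κ` times the
permutation matrix. -/
def RMatrixRelation {ι : Type*} (σ : ι → ι → ℚ) (κ : ℚ) (U V : Matrix ι ι A) : Prop :=
  ∀ s t u v, D.db (U s t) (V u v) =
    (1 / 2 : ℚ) • ((κ + σ s u) • (U u t ⊗ₜ[ℚ] V s v) + (-κ + σ t v) • (V u t ⊗ₜ[ℚ] U s v))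

/-- The product rule for two independent pairs, as for entries of transfer matrices of different
squares: only the brackets within the pairs survive. -/
theorem db_mul_mul {f f' g g' : A} (h : D.db f g' = 0) (h' : D.db f' g = 0) :
    D.db (f * f') (g * g') = (g ⊗ₜ[ℚ] f) * D.db f' g' + D.db f g * (f' ⊗ₜ[ℚ] g') := by
  rw [D.leibniz, D.leibniz_left, D.leibniz_left, h, h']
  have e1 : (f' ⊗ₜ[ℚ] g' : A ⊗[ℚ] A) = (f' ⊗ₜ 1) * (1 ⊗ₜ g') := by simp
  have e2 : (g ⊗ₜ[ℚ] f : A ⊗[ℚ] A) = (g ⊗ₜ 1) * (1 ⊗ₜ f) := by simp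
  rw [e1, e2, mul_zero, zero_mul, zero_add, add_zero, mul_assoc, mul_assoc, add_comm]

variable {D}

/-- Four terms arise for each pair of summation indices `a`, `b`. Two involve only the outer indices
and give the relation for the products. The other two carry `κ + σ a b` and `-κ + σ a b` in front of
the same tensors with `a` and `b` exchanged, so they cancel in the sum by skew-symmetry of `σ`. -/
theorem RMatrixRelation.mul {ι : Type*} [Fintype ι] {σ : ι → ι → ℚ}
    (hσ : ∀ s u, σ s u = -σ u s) {κ : ℚ} {U U' V V' : Matrix ι ι A}
    (h : D.RMatrixRelation σ κ U V) (h' : D.RMatrixRelation σ κ U' V')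
    (h1 : ∀ s t u v, D.db (U s t) (V' u v) = 0) (h2 : ∀ s t u v, D.db (U' s t) (V u v) = 0) :
    D.RMatrixRelation σ κ (U * U') (V * V') := by
  intro s t u v
  have e : ∀ a b, D.db (U s a * U' a t) (V u b * V' b v) =
      (1 / 2 : ℚ) • ((κ + σ a b) •
          ((V u b * U' b t) ⊗ₜ[ℚ] (U s a * V' a v)) +
        (-κ + σ t v) • ((V u b * V' b t) ⊗ₜ[ℚ] (U s a * U' a v)) +
        ((κ + σ s u) • ((U u a * U' a t) ⊗ₜ[ℚ] (V s b * V' b v)) +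
        (-κ + σ a b) • ((V u a * U' a t) ⊗ₜ[ℚ] (U s b * V' b v)))) := by
    intro a b
    rw [D.db_mul_mul (h1 _ _ _ _) (h2 _ _ _ _), h, h', mul_smul_comm, smul_mul_assoc, ← smul_add,
      mul_add, add_mul]
    simp only [mul_smul_comm, smul_mul_assoc, Algebra.TensorProduct.tmul_mul_tmul]
  simp only [Matrix.mul_apply, map_sum, LinearMap.sum_apply, e, TensorProduct.sum_tmul,
    TensorProduct.tmul_sum, ← Finset.smul_sum, Finset.sum_add_distrib]
  congr 1
  have key : ∑ b, ∑ a, (-κ + σ a b) • ((V u a * U' a t) ⊗ₜ[ℚ] (U s b * V' b v)) =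
      -∑ b, ∑ a, (κ + σ a b) • ((V u b * U' b t) ⊗ₜ[ℚ] (U s a * V' a v)) := by
    rw [Finset.sum_comm, ← Finset.sum_neg_distrib]
    refine Finset.sum_congr rfl fun a _ => ?_
    rw [← Finset.sum_neg_distrib]
    refine Finset.sum_congr rfl fun b _ => ?_
    rw [← neg_smul, neg_add, ← hσ]
  rw [key, Finset.sum_comm (f := fun x a => (V u x * V' x t) ⊗ₜ[ℚ] (U s a * U' a v))]
  abel

/-- Matrices related by the trigonometric `r`-matrix have commuting traces of powers. -/
theorem RMatrixRelation.trace_pow {ι : Type*} [Fintype ι] [DecidableEq ι]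
    {σ : ι → ι → ℚ} (hσ : ∀ s u, σ s u = -σ u s) {κ : ℚ} {U V : Matrix ι ι A}
    (h : D.RMatrixRelation σ κ U V) (i j : ℕ) :
    cyc (D.single (Matrix.trace (U ^ (i + 1))) (Matrix.trace (V ^ (j + 1)))) = 0 := by
  have hU : ∀ b g : A, sandwich 1 g (D.db (Matrix.trace (U ^ (i + 1))) b) =
      (i + 1) • ∑ s, ∑ t, sandwich ((U ^ i) t s) g (D.db (U s t) b) := by
    intro b g
    refine cyclicDerivation_trace (fun a f => sandwich f g (D.db a b)) ?_ ?_ ?_ ?_ U i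
    · intro f h; simp
    · intro f h; simp [sandwich_sum_left]
    · intro f; simpa using sandwich_sum_left (∅ : Finset (Fin 0)) (fun _ => (0 : A)) g (D.db f b)
    · intro f f' h
      rw [leibniz_left, map_add, sandwich_one_tmul_mul, sandwich_mul_tmul_one, add_comm]
  have hV : ∀ a : A, sandwich 1 1 (D.db a (Matrix.trace (V ^ (j + 1)))) =
      (j + 1) • ∑ u, ∑ v, sandwich 1 ((V ^ j) v u) (D.db a (V u v)) := by
    intro a
    refine cyclicDerivation_trace (fun b g => sandwich 1 g (D.db a b)) ?_ ?_ ?_ ?_ V j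
    · intro f h; simp
    · intro f h; simp [sandwich_sum_right]
    · intro f; simpa using sandwich_sum_right (∅ : Finset (Fin 0)) 1 (fun _ => (0 : A)) (D.db a f)
    · intro f f' h
      rw [D.leibniz, map_add, sandwich_mul_one_tmul, sandwich_tmul_one_mul]
  have key : ∑ u, ∑ v, ∑ s, ∑ t, sandwich ((U ^ i) t s) ((V ^ j) v u) (D.db (U s t) (V u v)) =
      0 := by
    -- In the second term the letter `V u t` is moved cyclically to the end, so that both terms
    -- become a word in `U` times a word in `V` and the inner sums complete the powers.
    have e1 : ∀ u v s t, sandwich ((U ^ i) t s) ((V ^ j) v u) (D.db (U s t) (V u v)) =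
        (1 / 2 : ℚ) • ((κ + σ s u) •
          cyc ((U u t * (U ^ i) t s) * (V s v * (V ^ j) v u)) +
        (-κ + σ t v) •
          cyc (((U ^ i) t s * U s v) * ((V ^ j) v u * V u t))) := by
      intro u v s t
      rw [h, map_smul, map_add, map_smul, map_smul, sandwich_tmul, sandwich_tmul]
      congr 3
      · simp only [mul_assoc]
      · rw [mul_assoc (V u t), mul_assoc (V u t), cyc_mul_comm]
        simp only [mul_assoc]
    have e2 : ∑ u, ∑ v, ∑ s, ∑ t, (κ + σ s u) •
          cyc ((U u t * (U ^ i) t s) * (V s v * (V ^ j) v u)) =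
        ∑ u, ∑ s, (κ + σ s u) •
          cyc ((U ^ (i + 1)) u s * (V ^ (j + 1)) s u) := by
      refine Finset.sum_congr rfl fun u _ => ?_
      rw [Finset.sum_comm]
      refine Finset.sum_congr rfl fun s _ => ?_
      rw [pow_succ' U, pow_succ' V, Matrix.mul_apply, Matrix.mul_apply, Finset.sum_mul_sum,
        map_sum, Finset.smul_sum, Finset.sum_comm]
      simp only [map_sum, Finset.smul_sum]
    have e3 : ∑ u, ∑ v, ∑ s, ∑ t, (-κ + σ t v) •
          cyc (((U ^ i) t s * U s v) * ((V ^ j) v u * V u t)) =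
        ∑ t, ∑ v, (-κ + σ t v) •
          cyc ((U ^ (i + 1)) t v * (V ^ (j + 1)) v t) := by
      have : ∀ t v, (-κ + σ t v) •
          cyc ((U ^ (i + 1)) t v * (V ^ (j + 1)) v t) =
          ∑ u, ∑ s, (-κ + σ t v) •
          cyc (((U ^ i) t s * U s v) * ((V ^ j) v u * V u t)) := by
        intro t v
        rw [pow_succ U, pow_succ V, Matrix.mul_apply, Matrix.mul_apply, Finset.sum_mul_sum,
          map_sum, Finset.smul_sum, Finset.sum_comm]
        simp only [map_sum, Finset.smul_sum]
      simp only [this]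
      rw [Finset.sum_comm]
      refine Eq.trans (Finset.sum_congr rfl fun v _ => ?_) Finset.sum_comm
      exact Finset.sum_comm_cycle
    refine Eq.trans (b := (1 / 2 : ℚ) • _) ?_ ((congrArg _ (congrArg₂ (· + ·) e2 e3)).trans ?_)
    · simp only [e1, smul_add, Finset.smul_sum, Finset.sum_add_distrib]
    -- Both terms are now sums over the same cyclic words, with coefficients `κ + σ s u` and `-κ + σ
    -- u s`, which add up to zero.
    rw [← Finset.sum_add_distrib]
    refine (congrArg _ (Finset.sum_eq_zero fun u _ => ?_)).trans (smul_zero _)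
    rw [← Finset.sum_add_distrib]
    refine Finset.sum_eq_zero fun s _ => ?_
    rw [← add_smul, hσ u s, add_add_add_comm, add_neg_cancel, add_neg_cancel, add_zero, zero_smul]
  rw [single, LinearMap.compr₂_apply, ← sandwich_one_one, hV]
  simp only [hU, ← Finset.smul_sum, key, smul_zero]

end DoubleBracket

/-! ### The transfer matrix of a single square -/

/-- The sign of the difference of two positions. -/
def posSign (s u : Fin 3) : ℚ := if s < u then -1 else if u < s then 1 else 0

theorem posSign_antisymm (s u : Fin 3) : posSign s u = -posSign u s := by
  revert s u; decide

namespace DoubleBracket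

variable {A : Type*} [Ring A] [Algebra ℚ A] (D : DoubleBracket A)

theorem skew_of_eq {a b u v : A} {r : ℚ} (h : D.db a b = r • u ⊗ₜ[ℚ] v) :
    D.db b a = -(r • v ⊗ₜ[ℚ] u) := by
  rw [D.skew a b, h, map_smul, TensorProduct.comm_tmul]

theorem skew_of_eq_zero {a b : A} (h : D.db a b = 0) : D.db b a = 0 := by
  rw [D.skew a b, h, map_zero, neg_zero]

/-- The transfer matrix of a square with left edge `l`, bottom edge `b`, right edge `r`, top edge
`q`, the edge `p` entering the top left corner and the edge `w` leaving the top right corner, with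
spectral parameter `x`. -/
def squareMatrix (p q r w l b : A) (x : ℚ) : Matrix (Fin 3) (Fin 3) A :=
  !![p * q * r, 0, x • (p * q * w); l * q * r + b, 0, x • (l * q * w); 0, 1, 0]

theorem squareMatrix_relation {p q r w l b : A}
    (pp : D.db p p = 0) (pq : D.db p q = 0) (pr : D.db p r = 0) (pw : D.db p w = 0)
    (lp : D.db l p = (1 / 2 : ℚ) • p ⊗ₜ[ℚ] l) (pb : D.db p b = 0)
    (qq : D.db q q = 0) (qr : D.db q r = 0) (qw : D.db q w = 0) (ql : D.db q l = 0)
    (qb : D.db q b = 0)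
    (rr : D.db r r = 0) (rw : D.db r w = (1 / 2 : ℚ) • r ⊗ₜ[ℚ] w) (rl : D.db r l = 0)
    (br : D.db b r = (1 / 2 : ℚ) • r ⊗ₜ[ℚ] b)
    (ww : D.db w w = 0) (wl : D.db w l = 0) (wb : D.db w b = 0)
    (ll : D.db l l = 0) (bl : D.db b l = (1 / 2 : ℚ) • b ⊗ₜ[ℚ] l) (bb : D.db b b = 0)
    {x y : ℚ} (hxy : x ≠ y) :
    D.RMatrixRelation posSign ((x + y) / (y - x)) (squareMatrix p q r w l b x)
      (squareMatrix p q r w l b y) := by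
  have hyx : y - x ≠ 0 := sub_ne_zero.2 hxy.symm
  have pl := D.skew_of_eq lp
  have wr := D.skew_of_eq rw
  have rb := D.skew_of_eq br
  have lb := D.skew_of_eq bl
  have qp := D.skew_of_eq_zero pq
  have rp := D.skew_of_eq_zero pr
  have wp := D.skew_of_eq_zero pw
  have bp := D.skew_of_eq_zero pb
  have rq := D.skew_of_eq_zero qr
  have wq := D.skew_of_eq_zero qw
  have lq := D.skew_of_eq_zero ql
  have bq := D.skew_of_eq_zero qb
  have lr := D.skew_of_eq_zero rl
  have lw := D.skew_of_eq_zero wl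
  have bw := D.skew_of_eq_zero wb
  intro s t u v
  fin_cases s <;> fin_cases t <;> fin_cases u <;> fin_cases v <;>
    simp [squareMatrix, posSign, D.db_one_left, D.db_one_right, D.leibniz, D.leibniz_left,
      pp, pq, pr, pw, lp, pb, qq, qr, qw, ql, qb, rr, rw, rl, br, ww, wl, wb, ll, bl, bb,
      pl, wr, rb, lb, qp, rp, wp, bp, rq, wq, lq, bq, lr, lw, bw,
      TensorProduct.add_tmul, TensorProduct.tmul_add, TensorProduct.tmul_smul,
      ← TensorProduct.smul_tmul', mul_assoc] <;>
    match_scalars <;> field_simp <;> ring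

end DoubleBracket

/-! ### Conjugation invariance of traces, and the empty strip -/

section CyclicTrace

variable {A ι : Type*} [Ring A] [Algebra ℚ A] [Fintype ι]

theorem cyc_trace_mul_comm (M N : Matrix ι ι A) :
    cyc (Matrix.trace (M * N)) = cyc (Matrix.trace (N * M)) := by
  simp only [Matrix.trace, Matrix.diag, Matrix.mul_apply, map_sum]
  rw [Finset.sum_comm]
  simp only [cyc_mul_comm]

theorem cyc_trace_conj_pow [DecidableEq ι] {G G' : Matrix ι ι A} (h : G' * G = 1)
    (M : Matrix ι ι A) (i : ℕ) :
    cyc (Matrix.trace ((G * M * G') ^ (i + 1))) = cyc (Matrix.trace (M ^ (i + 1))) := by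
  have e : ∀ i : ℕ, (G * M * G') ^ (i + 1) = G * M ^ (i + 1) * G' := by
    intro i
    induction i with
    | zero => simp
    | succ i ih =>
      rw [pow_succ, ih, pow_succ M (i + 1)]
      calc G * M ^ (i + 1) * G' * (G * M * G') = G * M ^ (i + 1) * (G' * G) * M * G' := by
            simp only [mul_assoc]
        _ = G * (M ^ (i + 1) * M) * G' := by rw [h]; simp only [mul_assoc, mul_one]
  rw [e, cyc_trace_mul_comm, ← mul_assoc, h, one_mul]

end CyclicTrace

/-- The base case for products. The left side is zero, and the right side can only be nonzero for `u
= t` and `s = v`, where the two coefficients cancel. -/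
theorem DoubleBracket.RMatrixRelation.one {A ι : Type*} [Ring A] [Algebra ℚ A] [DecidableEq ι]
    (D : DoubleBracket A) {σ : ι → ι → ℚ} (hσ : ∀ s u, σ s u = -σ u s) (κ : ℚ) :
    D.RMatrixRelation σ κ 1 1 := by
  intro s t u v
  have h : D.db ((1 : Matrix ι ι A) s t) ((1 : Matrix ι ι A) u v) = 0 := by
    rw [Matrix.one_apply]
    split_ifs
    · exact D.db_one_left _
    · simp
  rw [h, ← add_smul]
  by_cases hut : u = t
  · by_cases hsv : s = v
    · subst hut hsv
      rw [hσ u s, show κ + σ s u + (-κ + -σ s u) = 0 by ring, zero_smul, smul_zero]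
    · simp [Matrix.one_apply_ne hsv]
  · simp [Matrix.one_apply_ne hut]

/-! ### Locality of the bracket and the relation for the strip of squares -/

variable {n : ℕ}

/-- The square at whose corners an edge has its brackets. -/
def squareOf : Edge n → ZMod n
  | (.black, j) => j + 1
  | (_, j) => j

theorem edgeBracket_eq_zero {e f : Edge n} (h : squareOf e ≠ squareOf f) :
    edgeBracket e f = 0 := by
  obtain ⟨k, i⟩ := e
  obtain ⟨m, j⟩ := f
  cases k <;> cases m <;> simp only [squareOf] at h <;>
    simp [edgeBracket, edgeBracketAux, h, Ne.symm h]

theorem pentagramBracket_edge (e f : Edge n) :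
    (pentagramBracket n).db (mono (FreeGroup.of e)) (mono (FreeGroup.of f)) = edgeBracket e f :=
  DoubleBracket.ofGenerators_of _ _ _ _

/-- The subalgebra generated by the edges belonging to a set of squares. -/
def blockAlgebra (s : Set (ZMod n)) : Subalgebra ℚ (EdgeAlgebra n) :=
  Algebra.adjoin ℚ ((fun e => mono (FreeGroup.of e)) '' (squareOf ⁻¹' s))

theorem blockAlgebra_mono {s t : Set (ZMod n)} (h : s ⊆ t) : blockAlgebra s ≤ blockAlgebra t :=
  Algebra.adjoin_mono (Set.image_mono (Set.preimage_mono h))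

theorem edge_mem_blockAlgebra {s : Set (ZMod n)} (e : Edge n) (h : squareOf e ∈ s) :
    mono (FreeGroup.of e) ∈ blockAlgebra s :=
  Algebra.subset_adjoin ⟨e, h, rfl⟩

theorem db_algebraMap_right {A : Type*} [Ring A] [Algebra ℚ A] (D : DoubleBracket A) (f : A)
    (r : ℚ) : D.db f (algebraMap ℚ A r) = 0 := by
  rw [Algebra.algebraMap_eq_smul_one, map_smul, D.db_one_right, smul_zero]

/-- Vanishing on generators spreads by the Leibniz rules in both arguments. Generation as an
algebra, without inverses, suffices because entries of transfer matrices are polynomial in the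
edges. -/
theorem db_eq_zero_of_adjoin {A : Type*} [Ring A] [Algebra ℚ A] (D : DoubleBracket A) {S T : Set A}
    (h : ∀ a ∈ S, ∀ b ∈ T, D.db a b = 0) {f g : A} (hf : f ∈ Algebra.adjoin ℚ S)
    (hg : g ∈ Algebra.adjoin ℚ T) : D.db f g = 0 := by
  induction hf using Algebra.adjoin_induction with
  | mem a ha =>
    induction hg using Algebra.adjoin_induction with
    | mem b hb => exact h a ha b hb
    | algebraMap r => exact db_algebraMap_right D a r
    | add b c _ _ hb hc => rw [map_add, hb, hc, add_zero]
    | mul b c _ _ hb hc => rw [D.leibniz, hb, hc, zero_mul, mul_zero, add_zero]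
  | algebraMap r => exact D.skew_of_eq_zero (db_algebraMap_right D g r)
  | add b c _ _ hb hc => rw [map_add, LinearMap.add_apply, hb, hc, add_zero]
  | mul b c _ _ hb hc => rw [D.leibniz_left, hb, hc, zero_mul, mul_zero, add_zero]

theorem pentagramBracket_eq_zero {s t : Set (ZMod n)} (hst : Disjoint s t) {f g : EdgeAlgebra n}
    (hf : f ∈ blockAlgebra s) (hg : g ∈ blockAlgebra t) : (pentagramBracket n).db f g = 0 := by
  refine db_eq_zero_of_adjoin _ ?_ hf hg
  rintro _ ⟨e, he, rfl⟩ _ ⟨e', he', rfl⟩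
  exact (pentagramBracket_edge e e').trans
    (edgeBracket_eq_zero fun h => Set.disjoint_left.1 hst he (h ▸ he'))

/-- The transfer matrix of the square `k` of the toric network. -/
def stepMatrix (x : ℚ) (k : ZMod n) : Matrix (Fin 3) (Fin 3) (EdgeAlgebra n) :=
  DoubleBracket.squareMatrix (mono (edge .black (k - 1))) (mono (edge .top k))
    (mono (edge .right k)) (mono (edge .white k)) (mono (edge .left k)) (mono (edge .bottom k)) x

theorem stepMatrix_relation {x y : ℚ} (hxy : x ≠ y) (k : ZMod n) :
    (pentagramBracket n).RMatrixRelation posSign ((x + y) / (y - x)) (stepMatrix x k)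
      (stepMatrix y k) := by
  apply DoubleBracket.squareMatrix_relation _ _ _ _ _ _ _ _ _ _ _ _ _ _ _ _ _ _ _ _ _ _ hxy <;>
    refine (pentagramBracket_edge _ _).trans ?_ <;>
    simp [edgeBracket, edgeBracketAux, pureTensor, edge]

theorem stepMatrix_mem (x : ℚ) (k : ZMod n) (s t : Fin 3) :
    stepMatrix x k s t ∈ blockAlgebra {k} := by
  have h : ∀ m (j : ZMod n), squareOf (m, j) = k → mono (edge m j) ∈ blockAlgebra {k} :=
    fun m j hj => edge_mem_blockAlgebra (m, j) hj
  have hp := h .black (k - 1) (by simp [squareOf])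
  have hq := h .top k rfl
  have hr := h .right k rfl
  have hw := h .white k rfl
  have hl := h .left k rfl
  have hb := h .bottom k rfl
  fin_cases s <;> fin_cases t
  · exact mul_mem (mul_mem hp hq) hr
  · exact zero_mem _
  · exact Subalgebra.smul_mem _ (mul_mem (mul_mem hp hq) hw) x
  · exact add_mem (mul_mem (mul_mem hl hq) hr) hb
  · exact zero_mem _
  · exact Subalgebra.smul_mem _ (mul_mem (mul_mem hl hq) hw) x
  · exact zero_mem _
  · exact one_mem _
  · exact zero_mem _

/-- The product of the transfer matrices of the squares `0, …, k - 1`. -/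
def stripMatrix (n : ℕ) (x : ℚ) : ℕ → Matrix (Fin 3) (Fin 3) (EdgeAlgebra n)
  | 0 => 1
  | k + 1 => stripMatrix n x k * stepMatrix x (k : ZMod n)

theorem stripMatrix_mem (x : ℚ) (k : ℕ) (s t : Fin 3) :
    stripMatrix n x k s t ∈ blockAlgebra ((fun m : ℕ => (m : ZMod n)) '' Set.Iio k) := by
  induction k generalizing s t with
  | zero =>
    simp only [stripMatrix, Matrix.one_apply]
    split_ifs
    · exact one_mem _
    · exact zero_mem _
  | succ k ih =>
    rw [stripMatrix, Matrix.mul_apply]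
    refine sum_mem fun a _ => mul_mem (blockAlgebra_mono ?_ (ih s a))
      (blockAlgebra_mono ?_ (stepMatrix_mem x _ a t))
    · exact Set.image_mono (Set.Iio_subset_Iio k.le_succ)
    · rintro _ rfl
      exact ⟨k, k.lt_succ_self, rfl⟩

theorem stripMatrix_relation {x y : ℚ} (hxy : x ≠ y) {k : ℕ} (hk : k ≤ n) :
    (pentagramBracket n).RMatrixRelation posSign ((x + y) / (y - x)) (stripMatrix n x k)
      (stripMatrix n y k) := by
  induction k with
  | zero => exact .one _ posSign_antisymm _
  | succ k ih =>
    -- Here `k < n` matters: the squares `0, …, k` are still distinct modulo `n`, so the new factor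
    -- is independent of the previous ones.
    have hd : Disjoint ((fun m : ℕ => (m : ZMod n)) '' Set.Iio k) {(k : ZMod n)} := by
      rw [Set.disjoint_singleton_right]
      rintro ⟨m, hm, h⟩
      have hm : m < k := hm
      rw [ZMod.natCast_eq_natCast_iff', Nat.mod_eq_of_lt (by omega), Nat.mod_eq_of_lt (by omega)]
        at h
      omega
    refine .mul posSign_antisymm (ih (by omega)) (stepMatrix_relation hxy _) ?_ ?_
    · exact fun s t u v =>
        pentagramBracket_eq_zero hd (stripMatrix_mem x k s t) (stepMatrix_mem y _ u v)
    · exact fun s t u v =>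
        pentagramBracket_eq_zero hd.symm (stepMatrix_mem x _ s t) (stripMatrix_mem y k u v)

/-! ### Path sums on the cylinder as products of transfer matrices -/

namespace Network

variable {V E I R : Type*} [Finite E] [Semiring R] (N : Network V E I R)

/-- The sum of the weights of all directed paths between two vertices. -/
def pathSum (u v : V) : R := ∑ p ∈ (N.finite_paths u v).toFinset, N.pathWeight p

/-- Sort the paths by their first edge; there is one, since the empty path does not join distinct
vertices. -/
theorem pathSum_of_ne {u v : V} (huv : u ≠ v) (s : Finset E) (hs : ∀ e, e ∈ s ↔ N.src e = u) :
    N.pathSum u v = ∑ e ∈ s, N.weight e * N.pathSum (N.tgt e) v := by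
  classical
  have h : (N.finite_paths u v).toFinset = s.biUnion fun e =>
      (N.finite_paths (N.tgt e) v).toFinset.map ⟨List.cons e, List.cons_injective⟩ := by
    ext p
    cases p with
    | nil => simp [IsPath, huv]
    | cons e p => simp [IsPath, hs]
  rw [pathSum, h, Finset.sum_biUnion]
  · refine Finset.sum_congr rfl fun e _ => ?_
    simp [pathSum, pathWeight, Finset.mul_sum]
  · intro e _ e' _ hee
    simp only [Function.onFun, Finset.disjoint_left, Finset.mem_map, not_exists, not_and]
    rintro _ ⟨p, _, rfl⟩ q _ hq
    exact hee (List.cons.inj hq).1.symm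

theorem pathSum_of_terminal [DecidableEq V] {u v : V} (hu : ∀ e, N.src e ≠ u) :
    N.pathSum u v = if u = v then 1 else 0 := by
  have h : (N.finite_paths u v).toFinset = if u = v then {[]} else ∅ := by
    ext p
    cases p with
    | nil => by_cases huv : u = v <;> simp [IsPath, huv]
    | cons e p => split_ifs <;> simp [IsPath, hu]
  rw [pathSum, h]
  split_ifs <;> simp [pathWeight]

end Network

open LaurentPolynomial

variable {n : ℕ}

theorem C_mono_one :
    (C (mono (1 : FreeGroup (Edge n))) : LaurentPolynomial (EdgeAlgebra n)) = 1 := by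
  rw [mono, map_one, map_one]

/-- The factor collected on entering a vertex. -/
def entryMonomial : Vertex n → FreeGroup (Edge n)
  | .sink _ => Z n
  | _ => 1

/-- The sum of the weights of all paths from an edge ending at `v` to the sink `q`, including the
factor which the edge collects by ending at `v`. -/
def exitSum (v : Vertex n) (q : Fin 3) : LaurentPolynomial (EdgeAlgebra n) :=
  C (mono (entryMonomial v)) * (pentagramNetwork n).pathSum v (.sink q)

/-- The factor `Z` of an edge ending at a sink is charged to the sink, so that interior and final
edges obey the same recursion. The power of `λ` can be moved past it because `λ` is central. -/
theorem weight_mul_pathSum (e : CylinderEdge n) (g : FreeGroup (Edge n))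
    (hg : cylinderMonomial e = g * entryMonomial (cylinderTgt e)) (q : Fin 3) :
    (pentagramNetwork n).weight e * (pentagramNetwork n).pathSum (cylinderTgt e) (.sink q) =
      C (mono g) * T (cutCrossing e) * exitSum (cylinderTgt e) q := by
  simp only [pentagramNetwork, hg, exitSum, map_mul, mul_assoc]
  congr 1
  rw [← mul_assoc, ← mul_assoc, T_mul]

theorem exitSum_corner (p : Corner) (i : Fin n) (s : Finset (CylinderEdge n))
    (hs : ∀ e, e ∈ s ↔ cylinderSrc e = .corner p i) (g : CylinderEdge n → FreeGroup (Edge n))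
    (hg : ∀ e, cylinderMonomial e = g e * entryMonomial (cylinderTgt e)) (q : Fin 3) :
    exitSum (.corner p i) q =
      ∑ e ∈ s, C (mono (g e)) * T (cutCrossing e) * exitSum (cylinderTgt e) q := by
  rw [exitSum, show entryMonomial (.corner p i : Vertex n) = 1 from rfl, C_mono_one, one_mul,
    (pentagramNetwork n).pathSum_of_ne (by simp) s hs]
  exact Finset.sum_congr rfl fun e _ => weight_mul_pathSum e (g e) (hg e) q

/-- The edge weights without the factors of `Z` at the sinks. -/
def interiorMonomial : CylinderEdge n → FreeGroup (Edge n)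
  | .inr (.left, i) => X n i
  | .inr (.bottom, i) => Y n i
  | _ => 1

theorem cylinderMonomial_eq (e : CylinderEdge n) :
    cylinderMonomial e = interiorMonomial e * entryMonomial (cylinderTgt e) := by
  unfold cylinderMonomial interiorMonomial entryMonomial
  rfl

theorem exitSum_topRight (i : Fin n) (q : Fin 3) :
    exitSum (.corner .topRight i) q =
      exitSum (.corner .bottomRight i) q + T 1 * exitSum (toBottomLeft n (i + 2)) q := by
  rw [exitSum_corner .topRight i {.inr (.right, i), .inr (.white, i)} ?_ _ cylinderMonomial_eq]
  · rw [Finset.sum_pair (by simp)]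
    simp [interiorMonomial, cutCrossing, cylinderTgt, -MonoidAlgebra.of_apply, -T_mul]
  · rintro (s | ⟨k, j⟩)
    · simp [cylinderSrc]
    · cases k <;> simp [cylinderSrc]

theorem exitSum_topLeft (i : Fin n) (q : Fin 3) :
    exitSum (.corner .topLeft i) q = exitSum (.corner .topRight i) q := by
  rw [exitSum_corner .topLeft i {.inr (.top, i)} ?_ _ cylinderMonomial_eq]
  · simp [interiorMonomial, cutCrossing, cylinderTgt, -MonoidAlgebra.of_apply, -T_mul]
  · rintro (s | ⟨k, j⟩)
    · simp [cylinderSrc]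
    · cases k <;> simp [cylinderSrc]

theorem exitSum_bottomRight (i : Fin n) (q : Fin 3) :
    exitSum (.corner .bottomRight i) q = exitSum (toTopLeft n (i + 1)) q := by
  rw [exitSum_corner .bottomRight i {.inr (.black, i)} ?_ _ cylinderMonomial_eq]
  · simp [interiorMonomial, cutCrossing, cylinderTgt, -MonoidAlgebra.of_apply, -T_mul]
  · rintro (s | ⟨k, j⟩)
    · simp [cylinderSrc]
    · cases k <;> simp [cylinderSrc]

theorem exitSum_bottomLeft (i : Fin n) (q : Fin 3) :
    exitSum (.corner .bottomLeft i) q =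
      C (mono (X n i)) * exitSum (.corner .topLeft i) q +
        C (mono (Y n i)) * exitSum (.corner .bottomRight i) q := by
  rw [exitSum_corner .bottomLeft i {.inr (.left, i), .inr (.bottom, i)} ?_ _ cylinderMonomial_eq]
  · rw [Finset.sum_pair (by simp)]
    simp [interiorMonomial, cutCrossing, cylinderTgt, -MonoidAlgebra.of_apply, -T_mul]
  · rintro (s | ⟨k, j⟩)
    · simp [cylinderSrc]
    · cases k <;> simp [cylinderSrc]

theorem exitSum_sink (s q : Fin 3) :
    exitSum (.sink s : Vertex n) q = if s = q then C (mono (Z n)) else 0 := by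
  classical
  rw [exitSum, Network.pathSum_of_terminal]
  · simp [entryMonomial]
  · rintro (s | ⟨k, j⟩)
    · simp [pentagramNetwork, cylinderSrc]
    · cases k <;> simp [pentagramNetwork, cylinderSrc]

/-- The sums of the path weights from the three edges cut between the squares `k - 1` and `k` to
the sinks. -/
def tailMatrix (n k : ℕ) : Matrix (Fin 3) (Fin 3) (LaurentPolynomial (EdgeAlgebra n)) :=
  Matrix.of ![exitSum (toTopLeft n k), exitSum (toBottomLeft n k), exitSum (toBottomLeft n (k + 1))]

theorem boundaryMatrix_eq (n : ℕ) : boundaryMatrix n = tailMatrix n 0 := by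
  ext1 s q
  have h : boundaryMatrix n s q = exitSum (cylinderTgt (.inl s : CylinderEdge n)) q := by
    change (pentagramNetwork n).pathSum (.source s) (.sink q) = _
    rw [(pentagramNetwork n).pathSum_of_ne (by simp) {.inl s} ?_, Finset.sum_singleton]
    · refine (weight_mul_pathSum _ _ (cylinderMonomial_eq _) q).trans ?_
      simp [interiorMonomial, cutCrossing, -MonoidAlgebra.of_apply]
    · rintro (s | ⟨k, j⟩)
      · simp [pentagramNetwork, cylinderSrc]
      · cases k <;> simp [pentagramNetwork, cylinderSrc]
  rw [h]
  fin_cases s <;> rfl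

/-- The transfer matrix of the square `k` of the cylinder network. -/
def cylinderStep (n k : ℕ) : Matrix (Fin 3) (Fin 3) (LaurentPolynomial (EdgeAlgebra n)) :=
  !![1, 0, T 1;
    C (mono (X n k)) + C (mono (Y n k)), 0, C (mono (X n k)) * T 1;
    0, 1, 0]

/-- Passing one square moves the cut by one. The strand to the bottom left corner of square `k + 1`
bypasses square `k` and moves from third to second place, whence the last row `0, 1, 0`; the new
third strand is the white edge to square `k + 2`. -/
theorem tailMatrix_of_lt {k : ℕ} (hk : k < n) :
    tailMatrix n k = cylinderStep n k * tailMatrix n (k + 1) := by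
  have h1 : toTopLeft n k = .corner .topLeft ⟨k, hk⟩ := dif_pos hk
  have h2 : toBottomLeft n k = .corner .bottomLeft ⟨k, hk⟩ := dif_pos hk
  ext1 s q
  fin_cases s
  · simp [tailMatrix, cylinderStep, Matrix.mul_apply, Fin.sum_univ_three, h1, exitSum_topLeft,
      exitSum_topRight, exitSum_bottomRight]
  · simp [tailMatrix, cylinderStep, Matrix.mul_apply, Fin.sum_univ_three, h2, exitSum_topLeft,
      exitSum_topRight, exitSum_bottomRight, exitSum_bottomLeft, mul_add, add_mul, mul_assoc]
    abel
  · simp [tailMatrix, cylinderStep, Matrix.mul_apply, Fin.sum_univ_three]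

theorem tailMatrix_self (n : ℕ) :
    tailMatrix n n = Matrix.diagonal fun _ => C (mono (Z n)) := by
  have h1 : toTopLeft n n = .sink 0 := dif_neg (lt_irrefl n)
  have h2 : toBottomLeft n n = .sink 1 := by simp [toBottomLeft]
  have h3 : toBottomLeft n (n + 1) = .sink 2 := by simp [toBottomLeft]
  ext1 s q
  fin_cases s <;> simp [tailMatrix, h1, h2, h3, exitSum_sink, Matrix.diagonal_apply]

/-! ### Specialising `λ` and changing the gauge -/

/-- Evaluation of a Laurent polynomial at a nonzero rational number. -/
def evalAt {A : Type*} [Ring A] [Algebra ℚ A] (x : ℚˣ) : LaurentPolynomial A →+* A :=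
  AddMonoidAlgebra.liftNCRingHom (RingHom.id A)
    ((algebraMap ℚ A).toMonoidHom.comp ((Units.coeHom ℚ).comp (zpowersHom ℚˣ x)))
    fun a _ => show Commute _ _ from (Algebra.commutes _ a).symm

theorem evalAt_C_mul_T {A : Type*} [Ring A] [Algebra ℚ A] (x : ℚˣ) (a : A) (k : ℤ) :
    evalAt x (C a * T k) = (x : ℚ) ^ k • a := by
  rw [← single_eq_C_mul_T, Algebra.smul_def, Algebra.commutes]
  refine (AddMonoidAlgebra.liftNCRingHom_single _ _ _ _ _).trans ?_
  simp

theorem evalAt_eq_sum {A : Type*} [Ring A] [Algebra ℚ A] (x : ℚˣ) (f : LaurentPolynomial A) :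
    evalAt x f = f.coeff.sum fun k a => (x : ℚ) ^ k • a := by
  conv_lhs => rw [← AddMonoidAlgebra.sum_coeff_single f]
  rw [map_finsuppSum]
  simp only [single_eq_C_mul_T, evalAt_C_mul_T]

/-- The diagonal of the gauge transformation at the edges cut between the squares `k - 1`, `k`. -/
def gauge (n k : ℕ) : Fin 3 → FreeGroup (Edge n) :=
  ![stair n k, access n k, stair n k * (c ((k : ZMod n) - 1))⁻¹]

/-- A diagonal matrix of Laurent monomials. -/
def monoDiagonal (g : Fin 3 → FreeGroup (Edge n)) : Matrix (Fin 3) (Fin 3) (EdgeAlgebra n) :=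
  Matrix.diagonal fun s => mono (g s)

theorem monoDiagonal_mul (g h : Fin 3 → FreeGroup (Edge n)) :
    monoDiagonal g * monoDiagonal h = monoDiagonal (g * h) := by
  simp [monoDiagonal]

theorem monoDiagonal_one : monoDiagonal (1 : Fin 3 → FreeGroup (Edge n)) = 1 := by
  simp [monoDiagonal, -MonoidAlgebra.of_apply]

/-- The gauge factors are transports from the base point to the three cut points: the start of the
black edge entering square `k`, and the bottom left corners of squares `k` and `k + 1`. Cancellation
in the free group gives `X k = access k * a k * (stair k)⁻¹` and `Y k = access k * b k * (stair (k +
1))⁻¹`, so conjugating by these transports restores the original edges. -/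
theorem cylinderStep_gauge (x : ℚˣ) (k : ℕ) :
    (cylinderStep n k).map (evalAt x) * monoDiagonal (gauge n (k + 1)) =
      monoDiagonal (gauge n k) * stepMatrix (x : ℚ) (k : ZMod n) := by
  have e2 : ((k + 1 : ℕ) : ZMod n) - 2 = k - 1 := by push_cast; ring
  have hT : evalAt x (T 1 : LaurentPolynomial (EdgeAlgebra n)) = (x : ℚ) • 1 := by
    simpa using evalAt_C_mul_T x (1 : EdgeAlgebra n) 1
  have hC : ∀ a : EdgeAlgebra n, evalAt x (C a) = a := by
    intro a
    simpa using evalAt_C_mul_T x a 0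
  have w1 : stair n (k + 1) =
      stair n k * (edge .black ((k : ZMod n) - 1) * edge .top (k : ZMod n) * edge .right k) := by
    simp only [stair, d, c]; group
  have w2 : stair n (k + 1) * (c (k : ZMod n))⁻¹ =
      stair n k * (edge .black ((k : ZMod n) - 1) * edge .top (k : ZMod n) * edge .white k) := by
    simp only [stair, d, c]; group
  have w3 : X n k * stair n (k + 1) =
      access n k * (edge .left (k : ZMod n) * edge .top (k : ZMod n) * edge .right k) := by
    simp only [X, xLoop, access, stair, a, d, c]; group
  have w4 : Y n k * stair n (k + 1) = access n k * edge .bottom (k : ZMod n) := by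
    simp only [Y, yLoop, access, stair, b, d, c]; group
  have w5 : X n k * (stair n (k + 1) * (c (k : ZMod n))⁻¹) =
      access n k * (edge .left (k : ZMod n) * edge .top (k : ZMod n) * edge .white k) := by
    simp only [X, xLoop, access, stair, a, d, c]; group
  have w6 : access n (k + 1) = stair n k * (c ((k : ZMod n) - 1))⁻¹ := by
    rw [access, e2]
    simp only [stair, Nat.cast_add, Nat.cast_one, add_sub_cancel_right]; group
  ext1 s t
  rw [monoDiagonal, monoDiagonal, Matrix.mul_diagonal, Matrix.diagonal_mul]
  fin_cases s <;> fin_cases t <;>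
    simp [cylinderStep, stepMatrix, DoubleBracket.squareMatrix, gauge, hT, hC,
      -MonoidAlgebra.of_apply, -map_mul]
  · simp only [w1, map_mul]
  · simp only [w2, map_mul]
  · rw [add_mul, ← map_mul, ← map_mul, w3, w4, mul_add]
    simp only [map_mul]
  · rw [evalAt_C_mul_T, smul_mul_assoc, ← map_mul, w5, zpow_one]
    simp only [map_mul]
  · rw [w6]

/-- Since `n = 0` in `ZMod n`, the two gauges differ only in the staircase prefix, which is `Z` at
the end and trivial at the start. -/
theorem gauge_self (n : ℕ) : gauge n n = (fun _ => Z n) * gauge n 0 := by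
  funext s
  fin_cases s <;> simp [gauge, access, stair, Z, mul_assoc]

theorem boundaryMatrix_map_evalAt (x : ℚˣ) :
    (boundaryMatrix n).map (evalAt x) =
      monoDiagonal (gauge n 0) * stripMatrix n x n * monoDiagonal (gauge n 0)⁻¹ := by
  -- The first `k` squares are in the new gauge and the rest of the cylinder is still in the old
  -- one. At `k = n` the factor `Z` at the sinks cancels the monodromy of the gauge, leaving a
  -- conjugation.
  have key : ∀ k ≤ n, (boundaryMatrix n).map (evalAt x) =
      monoDiagonal (gauge n 0) * stripMatrix n x k *
        (monoDiagonal (gauge n k)⁻¹ * (tailMatrix n k).map (evalAt x)) := by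
    intro k hk
    induction k with
    | zero =>
      rw [stripMatrix, mul_one, ← mul_assoc, monoDiagonal_mul, mul_inv_cancel, monoDiagonal_one,
        one_mul, boundaryMatrix_eq]
    | succ k ih =>
      have e : monoDiagonal (gauge n k)⁻¹ * (cylinderStep n k).map (evalAt x) =
          stepMatrix (x : ℚ) (k : ZMod n) * monoDiagonal (gauge n (k + 1))⁻¹ := by
        calc _ = monoDiagonal (gauge n k)⁻¹ * ((cylinderStep n k).map (evalAt x) *
              monoDiagonal (gauge n (k + 1))) * monoDiagonal (gauge n (k + 1))⁻¹ := by
              rw [mul_assoc, mul_assoc, monoDiagonal_mul, mul_inv_cancel, monoDiagonal_one, mul_one]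
          _ = _ := by
              rw [cylinderStep_gauge, ← mul_assoc, monoDiagonal_mul, inv_mul_cancel,
                monoDiagonal_one, one_mul]
      rw [ih (by omega), tailMatrix_of_lt (by omega), Matrix.map_mul, ← mul_assoc (monoDiagonal _),
        e, stripMatrix]
      simp only [mul_assoc]
  rw [key n le_rfl, tailMatrix_self]
  congr 1
  have hZ : (Matrix.diagonal fun _ : Fin 3 => C (mono (Z n))).map (evalAt x) =
      monoDiagonal fun _ => Z n := by
    rw [Matrix.diagonal_map (map_zero _), monoDiagonal]
    congr 1
    funext s
    simpa using evalAt_C_mul_T x (mono (Z n)) 0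
  rw [hZ, monoDiagonal_mul, gauge_self]
  rw [mul_inv_rev, inv_mul_cancel_right]

/-! ### From values to coefficients -/

theorem finsupp_eq_zero_of_sum_zpow_smul {M : Type*} [AddCommGroup M] [Module ℚ M] (f : ℤ →₀ M)
    {s : Set ℚˣ} (hs : s.Infinite) (h : ∀ x ∈ s, (f.sum fun k m => (x : ℚ) ^ k • m) = 0) :
    f = 0 := by
  by_contra hf
  obtain ⟨k, hk⟩ := Finsupp.ne_iff.1 hf
  -- A linear functional that detects a nonzero coefficient reduces the claim to scalar Laurent
  -- polynomials; multiplying by a power `x ^ N` then clears the negative exponents.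
  obtain ⟨φ, hφ⟩ : ∃ φ : Module.Dual ℚ M, φ (f k) ≠ 0 := by
    by_contra! h0
    exact hk ((Module.forall_dual_apply_eq_zero_iff ℚ (f k)).1 h0)
  obtain ⟨N, hN⟩ : ∃ N : ℤ, ∀ m ∈ f.support, 0 ≤ m + N := by
    obtain ⟨B, hB⟩ := f.support.bddBelow
    exact ⟨-B, fun m hm => by linarith [hB hm]⟩
  let P : Polynomial ℚ := ∑ m ∈ f.support, Polynomial.monomial (m + N).toNat (φ (f m))
  have hroot : ∀ x ∈ s, P.eval (x : ℚ) = 0 := by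
    intro x hx
    have e := congrArg φ (h x hx)
    rw [Finsupp.sum, map_sum, map_zero] at e
    rw [Polynomial.eval_finsetSum, ← mul_zero ((x : ℚ) ^ N), ← e, Finset.mul_sum]
    refine Finset.sum_congr rfl fun m hm => ?_
    rw [Polynomial.eval_monomial, map_smul, smul_eq_mul, ← mul_assoc, ← zpow_add₀ x.ne_zero,
      ← zpow_natCast, Int.toNat_of_nonneg (hN m hm), add_comm N, mul_comm]
  have hP : P = 0 := by
    refine Polynomial.eq_zero_of_infinite_isRoot P ((hs.image Units.val_injective.injOn).mono ?_)
    rintro _ ⟨x, hx, rfl⟩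
    exact hroot x hx
  have hc : P.coeff (k + N).toNat = φ (f k) := by
    have hks : k ∈ f.support := Finsupp.mem_support_iff.2 hk
    rw [Polynomial.finsetSum_coeff, Finset.sum_eq_single_of_mem k hks, Polynomial.coeff_monomial,
      if_pos rfl]
    intro m hm hmk
    rw [Polynomial.coeff_monomial, if_neg]
    have := hN m hm
    have := hN k hks
    omega
  rw [hP, Polynomial.coeff_zero] at hc
  exact hφ hc.symm

theorem cyc_evalAt_trace (x : ℚˣ) (i : ℕ) :
    cyc (evalAt x (Matrix.trace (boundaryMatrix n ^ (i + 1)))) =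
      cyc (Matrix.trace (stripMatrix n x n ^ (i + 1))) := by
  have e : evalAt x (Matrix.trace (boundaryMatrix n ^ (i + 1))) =
      Matrix.trace ((boundaryMatrix n).map (evalAt x) ^ (i + 1)) := by
    rw [← RingHom.mapMatrix_apply, ← map_pow, RingHom.mapMatrix_apply]
    simp [Matrix.trace]
  rw [e, boundaryMatrix_map_evalAt, cyc_trace_conj_pow]
  rw [monoDiagonal_mul, inv_mul_cancel, monoDiagonal_one]

theorem induced_evalAt_trace {x y : ℚˣ} (hxy : x ≠ y) (i j : ℕ) :
    (pentagramBracket n).induced (cyc (evalAt x (Matrix.trace (boundaryMatrix n ^ (i + 1)))))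
      (cyc (evalAt y (Matrix.trace (boundaryMatrix n ^ (j + 1))))) = 0 := by
  rw [cyc_evalAt_trace, cyc_evalAt_trace, DoubleBracket.induced_cyc]
  exact (stripMatrix_relation (Units.val_injective.ne hxy) le_rfl).trace_pow posSign_antisymm i j

/-- A bilinear pairing of Laurent polynomials whose values at distinct points vanish is zero on all
pairs of coefficients. -/
theorem coeff_pairing_eq_zero {A M : Type*} [Ring A] [Algebra ℚ A] [AddCommGroup M] [Module ℚ M]
    (β : A →ₗ[ℚ] A →ₗ[ℚ] M) (f g : LaurentPolynomial A)
    (h : ∀ x y : ℚˣ, x ≠ y → β (evalAt x f) (evalAt y g) = 0) (k l : ℤ) :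
    β (f.coeff k) (g.coeff l) = 0 := by
  have hinf : Infinite ℚˣ := by
    refine Infinite.of_injective (fun m : ℕ => Units.mk0 ((m : ℚ) + 1) (by positivity)) ?_
    intro m m' hm
    simpa [Units.ext_iff] using hm
  -- Fix `x` and vary `y`: excluding the single value `y = x` still leaves infinitely many points.
  -- Once the coefficient of `g` is isolated, `x` varies without restriction.
  have h1 : ∀ x, g.coeff.mapRange (β (evalAt x f)) (map_zero _) = 0 := by
    intro x
    refine finsupp_eq_zero_of_sum_zpow_smul _ (Set.finite_singleton x).infinite_compl fun y hy => ?_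
    rw [Finsupp.sum_mapRange_index (by simp), ← h x y (Ne.symm hy), evalAt_eq_sum y g,
      map_finsuppSum]
    simp
  have h2 : f.coeff.mapRange (fun a => β a (g.coeff l)) (by simp) = 0 := by
    refine finsupp_eq_zero_of_sum_zpow_smul _ Set.infinite_univ fun x _ => ?_
    have e := DFunLike.congr_fun (h1 x) l
    rw [Finsupp.mapRange_apply, evalAt_eq_sum x f] at e
    rw [Finsupp.sum_mapRange_index (by simp)]
    simpa [Finsupp.sum] using e
  simpa using DFunLike.congr_fun h2 k

end GrassmannPentagram

end

theorem theorem14 (n : ℕ) (hn : 1 ≤ n) (i j : ℕ) (hi : 1 ≤ i) (hj : 1 ≤ j) (k l : ℤ) :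
    (GrassmannPentagram.pentagramBracket n).induced
      (GrassmannPentagram.cyc (GrassmannPentagram.invariant n i k))
      (GrassmannPentagram.cyc (GrassmannPentagram.invariant n j l)) = 0 := by
  obtain ⟨i, rfl⟩ := Nat.exists_eq_add_of_le' hi
  obtain ⟨j, rfl⟩ := Nat.exists_eq_add_of_le' hj
  exact GrassmannPentagram.coeff_pairing_eq_zero
    ((GrassmannPentagram.pentagramBracket n).induced.compl₁₂ GrassmannPentagram.cyc
      GrassmannPentagram.cyc) _ _
    (fun _ _ hxy => GrassmannPentagram.induced_evalAt_trace hxy i j) k l
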